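/- **Event structures.** An event structure $\mathcal E=(E,\le,\#)$ is a set $E$ of events with a partial order $\le$ and an irreflexive symmetric conflict relation $\#$ such that $\{e':e'\le e\}$ is finite for every $e$, and $e\#e'$, $e'\le e''$ imply $e\#e''$. A configuration is a finite, conflict-free, downward-closed subset of $E$; the domain $\mathcal D(\mathcal E)$ is the set of configurations ordered by inclusion. For a configuration $c$, the event structure $\mathcal E\setminus c$ rooted at $c$ is the restriction of $\mathcal E$ to the events that are neither in $c$ nor in conflict with an event of $c$. The conflict $e'\#e''$ is minimal ($e'\#_\mu e''$) if there is no event $e\neq e',e''$ with ($e\le e'$ and $e\#e''$) or ($e\le e''$ and $e\#e'$); $e\lessdot e'$ means that $e$ is an immediate predecessor of $e'$. A trace alphabet is a pair $(\Sigma,I)$ of a finite nonempty set $\Sigma$ and an irreflexive symmetric relation $I$ on $\Sigma$; put $D=(\Sigma\times\Sigma)\setminus I$. The event structure $\mathcal E$ is *trace-regular* if for some trace alphabet there is a labeling $\lambda:E\to\Sigma$ such that (1) $e\#_\mu e'$ implies $\lambda(e)\ne\lambda(e')$; (2) $e\lessdot e'$ or $e\#_\mu e'$ implies $(\lambda(e),\lambda(e'))\in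 D$; (3) $(\lambda(e),\lambda(e'))\in D$ implies $e\le e'$, $e'\le e$ or $e\#e'$; and such that the labeled event structures $(\mathcal E\setminus c,\lambda)$, $c\in\mathcal D(\mathcal E)$, fall into finitely many isomorphism classes. **Cube complexes.** A cube complex is *NPC* if the link of each vertex is a flag simplicial complex. Its hyperplanes correspond to the classes of the equivalence relation on edges generated by being opposite edges of a square. Two hyperplanes intersect if they are dual to consecutive edges of some square; they osculate if they are dual to distinct edges with a common end vertex $v$ that are not consecutive edges of a square at $v$. A complex is *special* if its hyperplanes are two-sided, do not self-intersect and do not directly self-osculate (osculate with themselves at two edges both directed towards, or both directed away from, the common vertex, for a consistent direction of the dual edges), and no two distinct hyperplanes both intersect and osculate. A finite NPC complex is *virtually special* if it has a finite special NPC cover. An admissible orientation $o$ of $X$ directs all edges so that opposite edges of each square have the same direction; it lifts to an orientation $\tilde o$ of the universal cover $\widetilde X$. For a vertex $\tilde v$ of $\widetilde X$, the principal filter of $\tilde v$ is the set of vertices reachable from $\tilde v$ by a directed path, ordered by the existence of a directed path. An event structure $\mathcal E$ is *strongly regular* if $\mathcal D(\mathcal E)$ is isomorphic, as a partially ordered set,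 to a principal filter of $(\widetilde X,\tilde o)$ for some finite NPC complex $X$ with an admissible orientation $o$. A strongly regular $\mathcal E$ is *cover-special* if this holds for some virtually special complex $X$ with an admissible orientation $o$. **Corollary.** Every trace-regular event structure is cover-special, and hence strongly regular. -/

import Mathlib

universe u

/-! ### Event structures -/

/-- An event structure on the partially ordered set `E` of events; `≤` is causal dependency. -/
structure EventStructure (E : Type u) [PartialOrder E] where
  /-- the conflict relation -/
  conflict : E → E → Prop
  conflict_irrefl : ∀ e, ¬ conflict e e
  conflict_symm : ∀ e e', conflict e e' → conflict e' e
  finite_causes : ∀ e : E, {e' : E | e' ≤ e}.Finite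
  conflict_inherit : ∀ e e' e'', conflict e e' → e' ≤ e'' → conflict e e''

namespace EventStructure

variable {E : Type u} [PartialOrder E] (S : EventStructure E)

/-- Minimal conflict. -/
def MinConflict (e₁ e₂ : E) : Prop :=
  S.conflict e₁ e₂ ∧
    ¬ ∃ e, e ≠ e₁ ∧ e ≠ e₂ ∧ ((e ≤ e₁ ∧ S.conflict e e₂) ∨ (e ≤ e₂ ∧ S.conflict e e₁))

/-- Configurations: finite, conflict-free, downward-closed sets of events. -/
def IsConfiguration (c : Finset E) : Prop :=
  (∀ e ∈ c, ∀ e' ∈ c, ¬ S.conflict e e') ∧ (∀ e ∈ c, ∀ e', e' ≤ e → e' ∈ c)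

/-- The domain of an event structure: its configurations, ordered by inclusion (the order is the
one inherited from `Finset E`). -/
abbrev Domain : Type u := {c : Finset E // S.IsConfiguration c}

/-- The events of the event structure rooted at `c`: those neither in `c` nor in conflict with an
event of `c`. -/
abbrev Residual (c : S.Domain) : Type u :=
  {e : E // e ∉ c.1 ∧ ¬ ∃ e' ∈ c.1, S.conflict e' e}

/-- The event structure rooted at `c`. -/
def rooted (c : S.Domain) : EventStructure (S.Residual c) where
  conflict e e' := S.conflict e.1 e'.1
  conflict_irrefl e := S.conflict_irrefl e.1
  conflict_symm e e' := S.conflict_symm e.1 e'.1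
  finite_causes e :=
    ((S.finite_causes e.1).preimage Subtype.val_injective.injOn).subset fun _ h => h
  conflict_inherit e e' e'' := S.conflict_inherit e.1 e'.1 e''.1

variable {A : Type} (lab : E → A)

/-- Two configurations are equivalent if the labeled event structures rooted at them are
isomorphic. -/
def labeledFutureSetoid : Setoid S.Domain where
  r c c' := ∃ f : S.Residual c ≃o S.Residual c',
    (∀ e e', (S.rooted c).conflict e e' ↔ (S.rooted c').conflict (f e) (f e')) ∧
      ∀ e, lab (f e).1 = lab e.1
  iseqv :=
    { refl := fun c => ⟨OrderIso.refl _, fun _ _ => Iff.rfl, fun _ => rfl⟩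
      symm := by
        rintro c c' ⟨f, hf, hl⟩
        refine ⟨f.symm, fun e e' => ?_, fun e => ?_⟩
        · rw [hf]; simp
        · rw [← hl]; simp
      trans := by
        rintro c c' c'' ⟨f, hf, hl⟩ ⟨g, hg, hm⟩
        exact ⟨f.trans g, fun e e' => (hf e e').trans (hg _ _), fun e => (hm _).trans (hl e)⟩ }

/-- The labeled event structure has finite index. -/
def HasFiniteLabeledIndex : Prop := Finite (Quotient (S.labeledFutureSetoid lab))

/-- `lab` is a trace labeling of `S` with the trace alphabet `(A, I)`. -/
structure IsTraceLabeling (I : A → A → Prop) : Prop where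
  les1 : ∀ e e', S.MinConflict e e' → lab e ≠ lab e'
  les2 : ∀ e e', e ⋖ e' ∨ S.MinConflict e e' → ¬ I (lab e) (lab e')
  les3 : ∀ e e', ¬ I (lab e) (lab e') → e ≤ e' ∨ e' ≤ e ∨ S.conflict e e'

/-- Trace-regular event structures: there are a trace alphabet `(A, I)`, that is, a finite nonempty
alphabet with an irreflexive symmetric independence relation, and a trace labeling for which the
labeled event structure has finite index. -/
def IsTraceRegular : Prop :=
  ∃ (A : Type) (_ : Finite A) (_ : Nonempty A) (I : A → A → Prop) (lab : E → A),
    (∀ a, ¬ I a a) ∧ (∀ a b, I a b → I b a) ∧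
      S.IsTraceLabeling lab I ∧ S.HasFiniteLabeledIndex lab

end EventStructure

/-! ### Cube complexes -/

/-- A face embedding of the `m`-cube `{0,1}^m` into the `n`-cube `{0,1}^n` (an isometric embedding
onto a face): `base` is the image of the origin, and the `i`-th coordinate direction is sent to
the direction `dir i`, pointing away from `base`. For `m = n` these are the symmetries of the
cube. -/
@[ext]
structure CubeFace (m n : ℕ) where
  dir : Fin m ↪ Fin n
  base : Fin n → Bool

namespace CubeFace

/-- The effect on the vertices of the cube. -/
def map {m n : ℕ} (f : CubeFace m n) (x : Fin m → Bool) : Fin n → Bool :=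
  fun j => xor (f.base j) (decide (∃ i, f.dir i = j ∧ x i = true))

/-- The identity of the `n`-cube. -/
def id (n : ℕ) : CubeFace n n := ⟨Function.Embedding.refl _, fun _ => false⟩

/-- The composition `g ∘ f` of face embeddings. -/
def comp {l m n : ℕ} (g : CubeFace m n) (f : CubeFace l m) : CubeFace l n :=
  ⟨f.dir.trans g.dir, g.map f.base⟩

theorem map_id (n : ℕ) (x : Fin n → Bool) : (id n).map x = x := by
  funext j
  simp [map, id]

theorem map_comp {l m n : ℕ} (g : CubeFace m n) (f : CubeFace l m) (x : Fin l → Bool) :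
    (g.comp f).map x = g.map (f.map x) := by
  funext j
  by_cases hj : ∃ i, g.dir i = j
  · obtain ⟨i, rfl⟩ := hj
    simp only [map, comp, Function.Embedding.trans_apply, EmbeddingLike.apply_eq_iff_eq,
      exists_eq_left, Bool.decide_eq_true, Bool.xor_assoc]
  · have h : ∀ i, g.dir i ≠ j := fun i hi => hj ⟨i, hi⟩
    simp [map, comp, h]

/-- The vertex `b` of the `n`-cube. -/
def vertex {n : ℕ} (b : Fin n → Bool) : CubeFace 0 n :=
  ⟨⟨fun i => i.elim0, fun i => i.elim0⟩, b⟩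

/-- The edge of the `n`-cube that leaves the vertex `b` in the direction `i`, oriented away
from `b`. -/
def edge {n : ℕ} (b : Fin n → Bool) (i : Fin n) : CubeFace 1 n :=
  ⟨⟨fun _ => i, fun _ _ _ => Subsingleton.elim _ _⟩, b⟩

end CubeFace

/-- A cube complex, given by its parametrized cubes. An element of `cube n` is an `n`-cube of the
complex together with an identification of it with the standard `n`-cube, so that every `n`-cube is
represented by `2^n * n!` elements, on which the symmetries of the standard cube act freely
(distinct faces of one cube may be identified with each other, but the interior of a cube is
embedded). In particular `cube 0` is the set of vertices, and `cube 1` is the set of edges with a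
chosen direction. -/
structure CubeComplex where
  cube : ℕ → Type u
  /-- restriction of a parametrized cube to a face of the standard cube -/
  face : ∀ {m n : ℕ}, CubeFace m n → cube n → cube m
  face_id : ∀ (n : ℕ) (c : cube n), face (CubeFace.id n) c = c
  face_comp : ∀ {l m n : ℕ} (g : CubeFace m n) (f : CubeFace l m) (c : cube n),
    face (g.comp f) c = face f (face g c)
  free : ∀ (n : ℕ) (f : CubeFace n n) (c : cube n), face f c = c → f = CubeFace.id n

namespace CubeComplex

section

variable (X : CubeComplex.{u})

/-- The complex has finitely many cubes (in particular it has finite dimension). -/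
def IsFinite : Prop := Finite (Σ n, X.cube n)

variable {X}

/-- The vertex of a parametrized cube at the origin. -/
def origin {n : ℕ} (c : X.cube n) : X.cube 0 := X.face (CubeFace.vertex fun _ => false) c

/-- The edge of a parametrized cube that leaves its origin in the direction `i`. -/
def originEdge {n : ℕ} (c : X.cube n) (i : Fin n) : X.cube 1 :=
  X.face (CubeFace.edge (fun _ => false) i) c

/-- The initial vertex of an oriented edge. -/
def source (e : X.cube 1) : X.cube 0 := X.face (CubeFace.vertex fun _ => false) e

/-- The terminal vertex of an oriented edge. -/
def target (e : X.cube 1) : X.cube 0 := X.face (CubeFace.vertex fun _ => true) e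

/-- The same edge with the other direction. -/
def flip (e : X.cube 1) : X.cube 1 := X.face (CubeFace.edge (fun _ => true) 0) e

/-- The side of a square from `(0,0)` to `(1,0)`. -/
def bottom (s : X.cube 2) : X.cube 1 := X.face (CubeFace.edge ![false, false] 0) s

/-- The side of a square from `(0,1)` to `(1,1)`. -/
def top (s : X.cube 2) : X.cube 1 := X.face (CubeFace.edge ![false, true] 0) s

/-- The side of a square from `(0,0)` to `(0,1)`. -/
def left (s : X.cube 2) : X.cube 1 := X.face (CubeFace.edge ![false, false] 1) s

/-- The side of a square from `(1,0)` to `(1,1)`. -/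
def right (s : X.cube 2) : X.cube 1 := X.face (CubeFace.edge ![true, false] 1) s

/-- The oriented edges `e`, `e'` leave a common vertex and are consecutive edges of a square at that
vertex; that is, `e` and `e'` are adjacent in the link of their common source. -/
def FormCorner (e e' : X.cube 1) : Prop := ∃ s : X.cube 2, bottom s = e ∧ left s = e'

variable (X)

/-- Nonpositively curved complexes: the link of every vertex is a flag simplicial complex. The
vertices of the link of `v` are the oriented edges that leave `v` (a loop gives two of them), and a
parametrized `d`-cube with origin `v` is a `(d-1)`-simplex of the link with an ordering of its
vertices. -/
structure IsNPC : Prop where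
  /-- the vertices of a simplex of the link are distinct -/
  link_nondegenerate : ∀ s : X.cube 2, bottom s ≠ left s
  /-- a simplex of the link is determined by its vertices -/
  link_simplicial : ∀ (d : ℕ) (c c' : X.cube d), origin c = origin c' →
    (∀ i, originEdge c i = originEdge c' i) → c = c'
  /-- every clique of the link spans a simplex -/
  link_flag : ∀ (d : ℕ) (v : X.cube 0) (e : Fin d → X.cube 1), (∀ i, source (e i) = v) →
    (∀ i j, i ≠ j → FormCorner (e i) (e j)) →
      ∃ c : X.cube d, origin c = v ∧ ∀ i, originEdge c i = e i

/-! ### Hyperplanes and special complexes -/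

/-- Two oriented edges are parallel: the equivalence relation generated by being opposite sides of a
square with the same direction. -/
def OrientedParallel : X.cube 1 → X.cube 1 → Prop :=
  Relation.EqvGen fun e e' => ∃ s : X.cube 2, e = bottom s ∧ e' = top s

/-- The hyperplanes, that is, the classes of the parallelism relation on the unoriented edges. -/
def Hyperplane : Type u :=
  Quot fun e e' : X.cube 1 => e' = flip e ∨ ∃ s : X.cube 2, e = bottom s ∧ e' = top s

variable {X}

/-- The hyperplane dual to an edge. -/
def hyperplane (e : X.cube 1) : X.Hyperplane := Quot.mk _ e

namespace Hyperplane

/-- A hyperplane is two-sided if its dual edges can be directed consistently: transport along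
squares never reverses a dual edge. -/
def IsTwoSided (H : X.Hyperplane) : Prop :=
  ∀ e : X.cube 1, hyperplane e = H → ¬ X.OrientedParallel e (flip e)

/-- Two hyperplanes intersect if they are dual to consecutive edges of some square. -/
def Intersect (H₁ H₂ : X.Hyperplane) : Prop :=
  ∃ s : X.cube 2, hyperplane (bottom s) = H₁ ∧ hyperplane (left s) = H₂

/-- A hyperplane self-intersects if it is dual to two consecutive edges of some square. -/
def SelfIntersects (H : X.Hyperplane) : Prop := Intersect H H

/-- `H₁` and `H₂` are dual to distinct edges `e₁`, `e₂` with a common end vertex (the edges are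
directed away from it) that are not consecutive edges of a square at that vertex. -/
def Osculate (H₁ H₂ : X.Hyperplane) : Prop :=
  ∃ e₁ e₂ : X.cube 1, source e₁ = source e₂ ∧ e₁ ≠ e₂ ∧ e₂ ≠ flip e₁ ∧ ¬ FormCorner e₁ e₂ ∧
    hyperplane e₁ = H₁ ∧ hyperplane e₂ = H₂

/-- Direct self-osculation: `H` osculates with itself at two edges such that the common vertex is
the source of both or the sink of both, for a consistent direction of the edges dual to `H`. -/
def DirectlySelfOsculates (H : X.Hyperplane) : Prop :=
  ∃ e₁ e₂ : X.cube 1, source e₁ = source e₂ ∧ e₁ ≠ e₂ ∧ e₂ ≠ flip e₁ ∧ ¬ FormCorner e₁ e₂ ∧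
    hyperplane e₁ = H ∧ X.OrientedParallel e₁ e₂

end Hyperplane

variable (X)

/-- Special cube complexes. -/
structure IsSpecial : Prop where
  two_sided : ∀ H : X.Hyperplane, H.IsTwoSided
  not_selfIntersects : ∀ H : X.Hyperplane, ¬ H.SelfIntersects
  not_directlySelfOsculates : ∀ H : X.Hyperplane, ¬ H.DirectlySelfOsculates
  not_interOsculate : ∀ H₁ H₂ : X.Hyperplane, H₁ ≠ H₂ → ¬ (H₁.Intersect H₂ ∧ H₁.Osculate H₂)

/-! ### Simple connectedness -/

variable {X}

/-- The list of oriented edges is an edge path from `u` to `v` in the 1-skeleton. -/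
def IsPath : X.cube 0 → List (X.cube 1) → X.cube 0 → Prop
  | u, [], v => u = v
  | u, e :: l, v => source e = u ∧ IsPath (target e) l v

/-- Elementary homotopies: deleting a backtracking, or replacing two consecutive sides of a square
by the other two sides. -/
def ElemHomotopy (p q : List (X.cube 1)) : Prop :=
  (∃ l l' e, p = l ++ [e, flip e] ++ l' ∧ q = l ++ l') ∨
    ∃ l l' s, p = l ++ [bottom s, right s] ++ l' ∧ q = l ++ [left s, top s] ++ l'

/-- Homotopy of edge paths from `u` to `v`. -/
def Homotopic {u v : X.cube 0} :
    {p : List (X.cube 1) // IsPath u p v} → {p : List (X.cube 1) // IsPath u p v} → Prop :=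
  Relation.EqvGen fun p q => ElemHomotopy p.1 q.1

variable (X)

/-- The complex is connected, and every closed edge path is null-homotopic. -/
structure IsSimplyConnected : Prop where
  nonempty : Nonempty (X.cube 0)
  connected : ∀ u v : X.cube 0, ∃ p, IsPath u p v
  null_homotopic : ∀ (v : X.cube 0) (p : {p : List (X.cube 1) // IsPath v p v}),
    Homotopic p ⟨[], rfl⟩

end

/-! ### Coverings -/

/-- Maps of cube complexes that send `n`-cubes to `n`-cubes and preserve faces. -/
structure Hom (Y X : CubeComplex.{u}) where
  map : ∀ {n : ℕ}, Y.cube n → X.cube n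
  map_face : ∀ {m n : ℕ} (f : CubeFace m n) (c : Y.cube n), map (Y.face f c) = X.face f (map c)

/-- Covering maps: surjections that restrict to a bijection from the star of every vertex `y` (with
multiplicities: all parametrized cubes with origin `y`) onto the star of its image. -/
structure Hom.IsCovering {Y X : CubeComplex.{u}} (φ : Hom Y X) : Prop where
  surjective : ∀ (n : ℕ) (c : X.cube n), ∃ d : Y.cube n, φ.map d = c
  star_bijective : ∀ (n : ℕ) (y : Y.cube 0) (c : X.cube n), origin c = φ.map y →
    ∃! d : Y.cube n, origin d = y ∧ φ.map d = c

/-- Universal covers: simply connected covers. -/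
structure Hom.IsUniversalCover {Y X : CubeComplex.{u}} (φ : Hom Y X) : Prop where
  covering : φ.IsCovering
  simply_connected : Y.IsSimplyConnected

/-- Virtually special complexes: finite NPC complexes with a finite special NPC cover. -/
def IsVirtuallySpecial (X : CubeComplex.{u}) : Prop :=
  X.IsFinite ∧ X.IsNPC ∧ ∃ (Y : CubeComplex.{u}) (φ : Hom Y X),
    Y.IsFinite ∧ Y.IsNPC ∧ Y.IsSpecial ∧ φ.IsCovering

/-! ### Directed complexes -/

/-- An admissible orientation: every edge gets exactly one of its two directions (`pos e` says that
`e` has the chosen direction), and opposite sides of every square get the same direction. -/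
structure AdmissibleOrientation (X : CubeComplex.{u}) where
  pos : X.cube 1 → Prop
  pos_flip : ∀ e, pos (flip e) ↔ ¬ pos e
  pos_parallel : ∀ s : X.cube 2, pos (bottom s) ↔ pos (top s)

namespace AdmissibleOrientation

/-- The orientation of `Y` induced along `φ : Y → X`. -/
def lift {Y X : CubeComplex.{u}} (o : X.AdmissibleOrientation) (φ : Hom Y X) :
    Y.AdmissibleOrientation where
  pos e := o.pos (φ.map e)
  pos_flip e := by
    have h : φ.map (flip e) = flip (φ.map e) := φ.map_face _ e
    rw [h]; exact o.pos_flip _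
  pos_parallel s := by
    have h₁ : φ.map (bottom s) = bottom (φ.map s) := φ.map_face _ s
    have h₂ : φ.map (top s) = top (φ.map s) := φ.map_face _ s
    rw [h₁, h₂]; exact o.pos_parallel _

/-- `o.Reach x y`: there is a directed path from `x` to `y`. -/
def Reach {X : CubeComplex.{u}} (o : X.AdmissibleOrientation) : X.cube 0 → X.cube 0 → Prop :=
  Relation.ReflTransGen fun x y => ∃ e : X.cube 1, o.pos e ∧ source e = x ∧ target e = y

/-- The vertices of the principal filter of `v`. -/
abbrev Filter {X : CubeComplex.{u}} (o : X.AdmissibleOrientation) (v : X.cube 0) : Type u :=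
  {x : X.cube 0 // o.Reach v x}

end AdmissibleOrientation

end CubeComplex

/-! ### Strongly regular and cover-special event structures -/

namespace EventStructure

variable {E : Type u} [PartialOrder E] (S : EventStructure E)

/-- For some admissible orientation of `X`, lifted to the universal cover `X'` of `X`, the domain of
`S` is isomorphic, as a partially ordered set, to a principal filter of `X'`. -/
def DomainIsFilterOfUniversalCover (X : CubeComplex.{0}) : Prop :=
  ∃ (o : X.AdmissibleOrientation) (X' : CubeComplex.{0}) (φ : CubeComplex.Hom X' X)
    (v : X'.cube 0), φ.IsUniversalCover ∧
      Nonempty ((fun c c' : S.Domain => c ≤ c') ≃r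
        (fun x y : (o.lift φ).Filter v => (o.lift φ).Reach x.1 y.1))

/-- Strongly regular event structures. -/
def IsStronglyRegular : Prop :=
  ∃ X : CubeComplex.{0}, X.IsFinite ∧ X.IsNPC ∧ S.DomainIsFilterOfUniversalCover X

/-- Cover-special event structures. -/
def IsCoverSpecial : Prop :=
  S.IsStronglyRegular ∧
    ∃ X : CubeComplex.{0}, X.IsVirtuallySpecial ∧ S.DomainIsFilterOfUniversalCover X

end EventStructure

/-!
A finite asynchronous machine can run through the configurations: its cells are indexed by the
letters, and an event labelled `a` reads the cells of the letters dependent on `a` and rewrites the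
cell of `a`. As in Zielonka's theorem, each cell stores finite information about the part of the
configuration below the last event with its letter. Time stamps taken from a finite set allow the
information in several cells to be merged, so that the cells read determine which events with label
`a` are enabled and what they write.

Changes of cells with independent letters commute, so the runs of the machine, with steps undone as
well as done, span a finite cube complex. It is special because each step has a letter which its
hyperplane inherits. The universal cover keeps track of the signed steps up to commutation and
cancellation, that is, of an element of a right-angled Artin group, represented by a reduced piling.
Sending a configuration to the contents of its cells and the piling of its events identifies the
domain with the principal filter of the initial vertex: distinct configurations have distinct
pilings, and every positive step out of a configuration adds exactly one enabled event.
-/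

namespace CubeFace

variable {m n : ℕ}

/-- The neighbour of the vertex `b` of the standard cube along the direction `i`. -/
def flipAt (b : Fin n → Bool) (i : Fin n) : Fin n → Bool := Function.update b i (!b i)

@[simp] theorem flipAt_self (b : Fin n → Bool) (i : Fin n) : flipAt b i i = !b i := by
  simp [flipAt]

theorem flipAt_of_ne (b : Fin n → Bool) {i j : Fin n} (h : j ≠ i) : flipAt b i j = b j := by
  simp [flipAt, h]

theorem flipAt_induction {P : (Fin n → Bool) → Prop} (zero : P fun _ => false)
    (flip : ∀ b i, b i = false → P b → P (flipAt b i)) (b : Fin n → Bool) : P b := by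
  have indicator : ∀ s : Finset (Fin n), P fun i => decide (i ∈ s) := by
    intro s
    induction s using Finset.induction_on with
    | empty => simpa using zero
    | insert i s hi ih =>
      convert flip _ i (by simpa using hi) ih using 1
      funext j
      by_cases hj : j = i
      · subst hj; simp [hi]
      · simp [flipAt_of_ne _ hj, hj]
  simpa using indicator (Finset.univ.filter fun i => b i = true)

theorem map_false (f : CubeFace m n) : f.map (fun _ => false) = f.base := by
  funext j
  simp [map]

theorem map_apply_dir (f : CubeFace m n) (b : Fin m → Bool) (i : Fin m) :
    f.map b (f.dir i) = xor (f.base (f.dir i)) (b i) := by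
  simp [map]

theorem map_flipAt (f : CubeFace m n) (b : Fin m → Bool) (i : Fin m) :
    f.map (flipAt b i) = flipAt (f.map b) (f.dir i) := by
  funext j
  by_cases hj : j = f.dir i
  · subst hj
    simp [map_apply_dir]
  · rw [flipAt_of_ne _ hj]
    have hne : ∀ k, f.dir k = j → k ≠ i := fun k hk hki => hj (by rw [← hk, hki])
    simp only [map]
    congr 2
    exact propext (exists_congr fun k => and_congr_right fun hk => by
      rw [flipAt_of_ne _ (hne k hk)])

theorem comp_vertex (f : CubeFace m n) (b : Fin m → Bool) :
    f.comp (vertex b) = vertex (f.map b) :=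
  CubeFace.ext (Subsingleton.elim _ _) rfl

theorem map_edge_false (b : Fin n → Bool) (i : Fin n) : (edge b i).map (fun _ => false) = b :=
  map_false _

theorem map_edge_true (b : Fin n → Bool) (i : Fin n) :
    (edge b i).map (fun _ => true) = flipAt b i := by
  have flip_zero : (fun _ => true : Fin 1 → Bool) = flipAt (fun _ => false) 0 := by decide
  rw [flip_zero, map_flipAt, map_edge_false]
  rfl

end CubeFace

namespace CubeComplex

open CubeFace

variable {X : CubeComplex.{u}} {n : ℕ}

theorem face_vertex_face {m : ℕ} (f : CubeFace m n) (b : Fin m → Bool) (c : X.cube n) :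
    X.face (vertex b) (X.face f c) = X.face (vertex (f.map b)) c := by
  rw [← X.face_comp, comp_vertex]

theorem source_face_edge (c : X.cube n) (b : Fin n → Bool) (i : Fin n) :
    source (X.face (edge b i) c) = X.face (vertex b) c := by
  rw [source, face_vertex_face, map_edge_false]

theorem target_face_edge (c : X.cube n) (b : Fin n → Bool) (i : Fin n) :
    target (X.face (edge b i) c) = X.face (vertex (flipAt b i)) c := by
  rw [target, face_vertex_face, map_edge_true]

theorem source_originEdge (c : X.cube n) (i : Fin n) : source (originEdge c i) = origin c :=
  source_face_edge c _ i

theorem source_flip (e : X.cube 1) : source (flip e) = target e :=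
  source_face_edge e _ 0

theorem target_flip (e : X.cube 1) : target (flip e) = source e := by
  rw [flip, target_face_edge, source, show flipAt (fun _ => true) 0 = fun _ => false by decide]

theorem flip_flip (e : X.cube 1) : flip (flip e) = e := by
  have edge_comp_edge :
      (edge (fun _ => true) 0).comp (edge (fun _ => true) 0) = CubeFace.id 1 :=
    CubeFace.ext (Function.Embedding.ext fun _ => Subsingleton.elim _ _) (by decide)
  rw [flip, flip, ← X.face_comp, edge_comp_edge, X.face_id]

theorem source_left (s : X.cube 2) : source (left s) = source (bottom s) :=
  (source_face_edge s _ 1).trans (source_face_edge s _ 0).symm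

theorem source_right (s : X.cube 2) : source (right s) = target (bottom s) := by
  rw [right, bottom, source_face_edge, target_face_edge,
    show flipAt ![false, false] 0 = ![true, false] by decide]

theorem source_top (s : X.cube 2) : source (top s) = target (left s) := by
  rw [top, left, source_face_edge, target_face_edge,
    show flipAt ![false, false] 1 = ![false, true] by decide]

theorem target_top (s : X.cube 2) : target (top s) = target (right s) := by
  rw [top, right, target_face_edge, target_face_edge,
    show flipAt ![false, true] 0 = flipAt ![true, false] 1 by decide]

/-! ### Homotopies of edge paths -/

variable {u v w z : X.cube 0} {p q r : List (X.cube 1)}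

theorem isPath_append : IsPath u (p ++ q) w ↔ ∃ v, IsPath u p v ∧ IsPath v q w := by
  induction p generalizing u with
  | nil => simp [IsPath]
  | cons e p ih => simp [IsPath, ih, and_assoc]

theorem isPath_singleton {e : X.cube 1} : IsPath u [e] v ↔ source e = u ∧ target e = v := Iff.rfl

theorem IsPath.append (hp : IsPath u p v) (hq : IsPath v q w) : IsPath u (p ++ q) w :=
  isPath_append.2 ⟨v, hp, hq⟩

theorem IsPath.reverse (h : IsPath u p v) : IsPath v (p.map flip).reverse u := by
  induction p generalizing u with
  | nil => exact h.symm
  | cons e p ih =>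
    obtain ⟨rfl, h⟩ := h
    rw [List.map_cons, List.reverse_cons]
    exact (ih h).append (isPath_singleton.2 ⟨source_flip e, target_flip e⟩)

/-- Homotopy of edge paths from `u` to `v`, as a relation on lists of edges: the subtype in
`Homotopic` makes concatenation awkward. -/
def PathHomotopic (u v : X.cube 0) (p q : List (X.cube 1)) : Prop :=
  ∃ (hp : IsPath u p v) (hq : IsPath u q v), Homotopic ⟨p, hp⟩ ⟨q, hq⟩

theorem ElemHomotopy.append (h : ElemHomotopy p q) (l l' : List (X.cube 1)) :
    ElemHomotopy (l ++ p ++ l') (l ++ q ++ l') := by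
  rcases h with ⟨m, m', e, rfl, rfl⟩ | ⟨m, m', s, rfl, rfl⟩
  · exact .inl ⟨l ++ m, m' ++ l', e, by simp, by simp⟩
  · exact .inr ⟨l ++ m, m' ++ l', s, by simp, by simp⟩

namespace PathHomotopic

theorem refl (h : IsPath u p v) : PathHomotopic u v p p := ⟨h, h, .refl _⟩

theorem symm : PathHomotopic u v p q → PathHomotopic u v q p
  | ⟨hp, hq, h⟩ => ⟨hq, hp, .symm _ _ h⟩

theorem trans : PathHomotopic u v p q → PathHomotopic u v q r → PathHomotopic u v p r
  | ⟨hp, _, h⟩, ⟨_, hr, h'⟩ => ⟨hp, hr, .trans _ _ _ h h'⟩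

theorem isPath_right (h : PathHomotopic u v p q) : IsPath u q v := h.2.1

theorem of_elemHomotopy (hp : IsPath u p v) (hq : IsPath u q v) (h : ElemHomotopy p q) :
    PathHomotopic u v p q := ⟨hp, hq, .rel _ _ h⟩

theorem append_append {l l' : List (X.cube 1)} (h : PathHomotopic v w p q)
    (hl : IsPath u l v) (hl' : IsPath w l' z) :
    PathHomotopic u z (l ++ p ++ l') (l ++ q ++ l') := by
  obtain ⟨hp, hq, h⟩ := h
  suffices H : ∀ a b : {p : List (X.cube 1) // IsPath v p w}, Homotopic a b →
      PathHomotopic u z (l ++ a.1 ++ l') (l ++ b.1 ++ l') from H _ _ h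
  intro a b hab
  induction hab with
  | rel a b h =>
    exact of_elemHomotopy ((hl.append a.2).append hl') ((hl.append b.2).append hl') (h.append l l')
  | refl a => exact refl ((hl.append a.2).append hl')
  | symm a b _ ih => exact ih.symm
  | trans a b c _ _ ih ih' => exact ih.trans ih'

theorem append_left (h : PathHomotopic v w p q) {l : List (X.cube 1)} (hl : IsPath u l v) :
    PathHomotopic u w (l ++ p) (l ++ q) := by
  simpa using h.append_append hl (l' := []) rfl

theorem append_right (h : PathHomotopic u v p q) {l : List (X.cube 1)} (hl : IsPath v l w) :
    PathHomotopic u w (p ++ l) (q ++ l) := by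
  simpa using h.append_append (l := []) rfl hl

theorem backtrack {e : X.cube 1} (h : IsPath u (p ++ [e, flip e]) v) :
    PathHomotopic u v (p ++ [e, flip e]) p := by
  refine of_elemHomotopy h ?_ (.inl ⟨p, [], e, by simp, by simp⟩)
  obtain ⟨_, hp, rfl, -, hv⟩ := isPath_append.1 h
  have hv : target (flip e) = v := hv
  rwa [← hv, target_flip]

theorem reverse_append (h : IsPath u p v) : PathHomotopic v v ((p.map flip).reverse ++ p) [] := by
  induction p generalizing u with
  | nil => exact refl rfl
  | cons e p ih =>
    obtain ⟨rfl, h⟩ := h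
    have cancel : PathHomotopic v (target e) ((p.map flip).reverse ++ [flip e, flip (flip e)])
        (p.map flip).reverse :=
      backtrack (h.reverse.append ⟨source_flip e, source_flip _, congrArg target (flip_flip e)⟩)
    simpa [flip_flip] using (cancel.append_right h).trans (ih h)

end PathHomotopic

theorem isSimplyConnected_of_pathHomotopic (v₀ : X.cube 0) (conn : ∀ v, ∃ p, IsPath v₀ p v)
    (homotopic : ∀ v p q, IsPath v₀ p v → IsPath v₀ q v → PathHomotopic v₀ v p q) :
    X.IsSimplyConnected where
  nonempty := ⟨v₀⟩
  connected u v := by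
    obtain ⟨p, hp⟩ := conn u
    obtain ⟨q, hq⟩ := conn v
    exact ⟨_, hp.reverse.append hq⟩
  null_homotopic v p := by
    obtain ⟨q, hq⟩ := conn v
    have cancel : PathHomotopic v v ((q.map flip).reverse ++ q) [] := .reverse_append hq
    have absorb : PathHomotopic v₀ v (q ++ p.1) q := homotopic v _ _ (hq.append p.2) hq
    have conjugate : PathHomotopic v v ((q.map flip).reverse ++ q ++ p.1)
        ((q.map flip).reverse ++ q) := by
      simpa using absorb.append_left hq.reverse
    exact (((cancel.append_right p.2).symm.trans conjugate).trans cancel).2.2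

end CubeComplex

/-- A set of letters with an independence relation. -/
structure IndependenceAlphabet (T : Type*) where
  indep : T → T → Prop
  irrefl : ∀ t, ¬ indep t t
  symm : ∀ {t t'}, indep t t' → indep t' t

namespace SignedLetter

variable {T : Type*} (d : T × Bool)

/-- The formal inverse of a signed letter; `(t, true)` stands for `t` itself. -/
def inv : T × Bool := (d.1, !d.2)

@[simp] theorem inv_inv : inv (inv d) = d := by simp [inv]

/-- The signed letter `d`, inverted if `b` is true. -/
def turn (b : Bool) : T × Bool := (d.1, xor d.2 b)

@[simp] theorem turn_false : turn d false = d := by simp [turn]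

@[simp] theorem turn_true : turn d true = inv d := by simp [turn, inv]

@[simp] theorem turn_turn (a b : Bool) : turn (turn d a) b = turn d (xor a b) := by simp [turn]

end SignedLetter

namespace IndependenceAlphabet

open SignedLetter

variable {T : Type*} (A : IndependenceAlphabet T)

theorem ne_of_indep {A : IndependenceAlphabet T} {t t' : T} (h : A.indep t t') : t' ≠ t := by
  rintro rfl
  exact A.irrefl _ h

/-- The exchange of two consecutive independent letters of a word. -/
def Swap (w w' : List (T × Bool)) : Prop :=
  ∃ u z d d', A.indep d.1 d'.1 ∧ w = u ++ [d, d'] ++ z ∧ w' = u ++ [d', d] ++ z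

/-- Trace equivalence: words that agree up to exchanging independent letters. -/
def SwapEq : List (T × Bool) → List (T × Bool) → Prop := Relation.ReflTransGen A.Swap

open Classical in
/-- Piling of a signed letter onto a family of stacks, one for each letter: the sign of `d` is put
on the stack of `d`, and a marker `none` on the stacks of the other letters dependent on `d`. -/
noncomputable def push (d : T × Bool) (r : T → List (Option Bool)) : T → List (Option Bool) :=
  fun t => if t = d.1 then some d.2 :: r t else if A.indep d.1 t then r t else none :: r t

open Classical in
/-- Removal of the top of the stacks of all letters dependent on `t`, which undoes `push`. -/
noncomputable def pop (t : T) (r : T → List (Option Bool)) : T → List (Option Bool) :=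
  fun t' => if A.indep t t' then r t' else (r t').tail

/-- The signed letter `d` lies on top of the piling. -/
def IsTop (d : T × Bool) (r : T → List (Option Bool)) : Prop := (r d.1).head? = some (some d.2)

open Classical in
/-- The action of a signed letter on pilings, which cancels the inverse letter if that is on top.
On reduced pilings, this is multiplication in the right-angled Artin group. -/
noncomputable def act (d : T × Bool) (r : T → List (Option Bool)) : T → List (Option Bool) :=
  if IsTop (inv d) r then A.pop d.1 r else A.push d r

/-- The piling of a word. -/
noncomputable def pile (w : List (T × Bool)) : T → List (Option Bool) :=
  w.foldl (fun r d => A.push d r) fun _ => []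

/-- Reduced pilings: those of words in which no letter can be cancelled. They represent the elements
of the right-angled Artin group. -/
def IsReduced (r : T → List (Option Bool)) : Prop :=
  (∃ w, A.pile w = r) ∧ ∀ t, (r t).IsChain fun x y => ∀ ε, x = some ε → y ≠ some !ε

variable {A} {d d' : T × Bool} {t t' : T} {w w' : List (T × Bool)} {r : T → List (Option Bool)}

theorem Swap.append (h : A.Swap w w') (l : List (T × Bool)) : A.Swap (w ++ l) (w' ++ l) := by
  obtain ⟨u, z, d, d', hI, rfl, rfl⟩ := h
  exact ⟨u, z ++ l, d, d', hI, by simp, by simp⟩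

theorem SwapEq.append (h : A.SwapEq w w') (l : List (T × Bool)) : A.SwapEq (w ++ l) (w' ++ l) :=
  Relation.ReflTransGen.lift (p := A.Swap) (· ++ l) (fun _ _ h' => Swap.append h' l) _ _ h

theorem pile_nil : A.pile [] = fun _ => [] := rfl

theorem pile_concat (w : List (T × Bool)) (d : T × Bool) :
    A.pile (w ++ [d]) = A.push d (A.pile w) := by
  simp [pile]

theorem push_self (d : T × Bool) (r : T → List (Option Bool)) :
    A.push d r d.1 = some d.2 :: r d.1 := by
  simp [push]

theorem push_of_indep (h : A.indep d.1 t) (r : T → List (Option Bool)) : A.push d r t = r t := by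
  simp [push, h, ne_of_indep h]

theorem pop_of_indep (h : A.indep t t') (r : T → List (Option Bool)) : A.pop t r t' = r t' := by
  simp [pop, h]

theorem not_isTop_nil : ¬ IsTop d fun _ => [] := by simp [IsTop]

theorem isTop_push_iff : IsTop d' (A.push d r) ↔ d' = d ∨ A.indep d.1 d'.1 ∧ IsTop d' r := by
  by_cases same : d'.1 = d.1
  · simp [IsTop, same, push_self, A.irrefl, Prod.ext_iff, eq_comm]
  · have ne : d' ≠ d := fun h => same (congrArg Prod.fst h)
    by_cases hI : A.indep d.1 d'.1 <;> simp [IsTop, push, same, hI, ne]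

theorem isTop_push (d : T × Bool) (r : T → List (Option Bool)) : IsTop d (A.push d r) :=
  isTop_push_iff.2 (.inl rfl)

theorem pop_push (d : T × Bool) (r : T → List (Option Bool)) : A.pop d.1 (A.push d r) = r := by
  funext t
  by_cases h : A.indep d.1 t
  · rw [pop_of_indep h, push_of_indep h]
  · by_cases ht : t = d.1 <;> simp [pop, push, h, ht, A.irrefl]

theorem push_comm (h : A.indep d.1 d'.1) (r : T → List (Option Bool)) :
    A.push d (A.push d' r) = A.push d' (A.push d r) := by
  have h' := A.symm h
  funext t
  by_cases h1 : t = d.1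
  · subst h1
    rw [push_self, push_of_indep h', push_of_indep h', push_self]
  · by_cases h2 : t = d'.1
    · subst h2
      rw [push_self, push_of_indep h, push_of_indep h, push_self]
    · simp only [push, h1, h2, if_false]
      split_ifs <;> rfl

theorem pop_comm (t t' : T) (r : T → List (Option Bool)) :
    A.pop t (A.pop t' r) = A.pop t' (A.pop t r) := by
  funext t''
  simp only [pop]
  split_ifs <;> rfl

theorem act_of_isTop (h : IsTop (inv d) r) : A.act d r = A.pop d.1 r := if_pos h

theorem act_of_not_isTop (h : ¬ IsTop (inv d) r) : A.act d r = A.push d r := if_neg h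

theorem act_of_indep (h : A.indep d.1 t) (r : T → List (Option Bool)) : A.act d r t = r t := by
  by_cases hd : IsTop (inv d) r
  · rw [act_of_isTop hd, pop_of_indep h]
  · rw [act_of_not_isTop hd, push_of_indep h]

theorem isTop_act_of_indep (h : A.indep d.1 d'.1) : IsTop d' (A.act d r) ↔ IsTop d' r := by
  rw [IsTop, act_of_indep h, IsTop]

/-! ### Pilings represent traces -/

theorem Swap.pile_eq (h : A.Swap w w') : A.pile w = A.pile w' := by
  obtain ⟨u, z, d, d', hI, rfl, rfl⟩ := h
  simp [pile, push_comm hI]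

theorem SwapEq.pile_eq (h : A.SwapEq w w') : A.pile w = A.pile w' := by
  induction h with
  | refl => rfl
  | tail _ h ih => exact ih.trans h.pile_eq

theorem exists_swapEq_concat (h : IsTop d (A.pile w)) : ∃ u, A.SwapEq w (u ++ [d]) := by
  induction w using List.reverseRecOn with
  | nil => exact absurd h not_isTop_nil
  | append_singleton u c ih =>
    rw [pile_concat, isTop_push_iff] at h
    rcases h with rfl | ⟨hI, h⟩
    · exact ⟨u, .refl⟩
    · obtain ⟨u', hu⟩ := ih h
      exact ⟨u' ++ [c], (hu.append [c]).tail ⟨u', [], d, c, A.symm hI, by simp, by simp⟩⟩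

theorem swapEq_of_pile_eq (h : A.pile w = A.pile w') : A.SwapEq w w' := by
  induction w' using List.reverseRecOn generalizing w with
  | nil =>
    rcases List.eq_nil_or_concat w with rfl | ⟨u, c, rfl⟩
    · exact .refl
    · have := congrFun h c.1
      rw [List.concat_eq_append, pile_concat, push_self, pile_nil] at this
      simp at this
  | append_singleton u d ih =>
    rw [pile_concat] at h
    obtain ⟨u', hu⟩ := exists_swapEq_concat (h ▸ isTop_push d (A.pile u))
    have piles_eq : A.pile u' = A.pile u := by
      rw [hu.pile_eq, pile_concat] at h
      rw [← pop_push d (A.pile u'), h, pop_push]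
    exact hu.trans ((ih piles_eq).append [d])

/-! ### The action on reduced pilings -/

theorem isReduced_nil : A.IsReduced fun _ => [] := ⟨⟨[], rfl⟩, fun _ => .nil⟩

namespace IsReduced

theorem exists_push_eq (hr : A.IsReduced r) (h : IsTop d r) : ∃ w, A.push d (A.pile w) = r := by
  obtain ⟨⟨w, rfl⟩, -⟩ := hr
  obtain ⟨u, hu⟩ := exists_swapEq_concat h
  exact ⟨u, by rw [hu.pile_eq, pile_concat]⟩

theorem push_pop (hr : A.IsReduced r) (h : IsTop d r) : A.push d (A.pop d.1 r) = r := by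
  obtain ⟨w, rfl⟩ := hr.exists_push_eq h
  rw [pop_push]

theorem pop (hr : A.IsReduced r) (h : IsTop d r) : A.IsReduced (A.pop d.1 r) := by
  refine ⟨?_, fun t => ?_⟩
  · obtain ⟨w, rfl⟩ := hr.exists_push_eq h
    exact ⟨w, (pop_push d _).symm⟩
  · unfold IndependenceAlphabet.pop
    split_ifs
    · exact hr.2 t
    · exact (hr.2 t).tail

theorem push (hr : A.IsReduced r) (h : ¬ IsTop (inv d) r) : A.IsReduced (A.push d r) := by
  obtain ⟨⟨w, rfl⟩, hc⟩ := hr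
  refine ⟨⟨w ++ [d], pile_concat _ _⟩, fun t => ?_⟩
  unfold IndependenceAlphabet.push
  split_ifs with same hI
  · subst same
    refine List.isChain_cons.2 ⟨fun y hy ε hε hyε => h ?_, hc _⟩
    rw [Option.some.injEq] at hε
    rw [Option.mem_def] at hy
    rw [IsTop, inv, hy, hyε, hε]
  · exact hc t
  · exact List.isChain_cons.2 ⟨fun _ _ ε hε => by simp at hε, hc _⟩

theorem act (hr : A.IsReduced r) (d : T × Bool) : A.IsReduced (A.act d r) := by
  by_cases h : IsTop (inv d) r
  · rw [act_of_isTop h]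
    exact hr.pop (d := inv d) h
  · rw [act_of_not_isTop h]
    exact hr.push h

theorem not_isTop_pop (hr : A.IsReduced r) (h : IsTop (inv d) r) : ¬ IsTop d (A.pop d.1 r) := by
  have chain := hr.2 d.1
  have top : r d.1 = some (!d.2) :: A.pop d.1 r d.1 := by
    conv_lhs => rw [← hr.push_pop h]
    exact push_self (inv d) _
  rw [top, List.isChain_cons] at chain
  exact fun h' => chain.1 _ h' _ rfl (by simp)

theorem act_inv_act (hr : A.IsReduced r) (d : T × Bool) : A.act (inv d) (A.act d r) = r := by
  by_cases h : IsTop (inv d) r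
  · rw [act_of_isTop h, act_of_not_isTop (by rw [inv_inv]; exact hr.not_isTop_pop h)]
    exact hr.push_pop h
  · rw [act_of_not_isTop h, act_of_isTop (by rw [inv_inv]; exact isTop_push d r)]
    exact pop_push d r

theorem pop_push_comm (hr : A.IsReduced r) (hI : A.indep d.1 d'.1) (h : IsTop (inv d) r) :
    A.pop d.1 (A.push d' r) = A.push d' (A.pop d.1 r) := by
  conv_lhs => rw [← hr.push_pop h, push_comm (d := d') (d' := inv d) (A.symm hI)]
  exact pop_push (inv d) _

theorem act_comm (hr : A.IsReduced r) (hI : A.indep d.1 d'.1) :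
    A.act d (A.act d' r) = A.act d' (A.act d r) := by
  have hI' := A.symm hI
  have top := isTop_act_of_indep (d' := inv d) (r := r) hI'
  have top' := isTop_act_of_indep (d' := inv d') (r := r) hI
  by_cases h : IsTop (inv d) r <;> by_cases h' : IsTop (inv d') r
  · rw [act_of_isTop (top.2 h), act_of_isTop (top'.2 h'), act_of_isTop h, act_of_isTop h']
    exact pop_comm _ _ _
  · rw [act_of_isTop (top.2 h), act_of_not_isTop (mt top'.1 h'), act_of_isTop h,
      act_of_not_isTop h']
    exact hr.pop_push_comm hI h
  · rw [act_of_not_isTop (mt top.1 h), act_of_isTop (top'.2 h'), act_of_not_isTop h,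
      act_of_isTop h']
    exact (hr.pop_push_comm hI' h').symm
  · rw [act_of_not_isTop (mt top.1 h), act_of_not_isTop (mt top'.1 h'), act_of_not_isTop h,
      act_of_not_isTop h']
    exact push_comm hI _

end IsReduced

end IndependenceAlphabet

/-! ### The cube complex of a reversible system -/

/-- A transition system with reversible deterministic steps, labelled by signed letters, in which
independent steps from the same state complete to a square. Its cubes form a special cube
complex. -/
structure ReversibleSystem {T : Type u} (A : IndependenceAlphabet T) where
  V : Type u
  step : V → T × Bool → V → Prop
  step_inv : ∀ {v d w}, step v d w → step w (SignedLetter.inv d) v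
  step_det : ∀ {v d w w'}, step v d w → step v d w' → w = w'
  diamond : ∀ {v d d' w w'}, A.indep d.1 d'.1 → step v d w → step v d' w' →
    ∃ u, step w d' u ∧ step w' d u

namespace ReversibleSystem

open SignedLetter IndependenceAlphabet CubeFace CubeComplex

variable {T : Type u} {A : IndependenceAlphabet T} (M : ReversibleSystem A)

/-- Parametrized cubes of the system: states at the vertices of the standard `n`-cube that are
joined by steps with independent labels, where parallel edges have the same label. -/
@[ext]
structure Cube (n : ℕ) where
  vtx : (Fin n → Bool) → M.V
  dir : Fin n → T × Bool
  indep : ∀ i j, i ≠ j → A.indep (dir i).1 (dir j).1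
  step : ∀ b i, M.step (vtx b) (turn (dir i) (b i)) (vtx (flipAt b i))

variable {M} {m n : ℕ}

namespace Cube

/-- The restriction of a cube to a face of the standard cube. -/
def face (f : CubeFace m n) (c : M.Cube n) : M.Cube m where
  vtx b := c.vtx (f.map b)
  dir i := turn (c.dir (f.dir i)) (f.base (f.dir i))
  indep i j h := c.indep _ _ fun h' => h (f.dir.injective h')
  step b i := by
    rw [turn_turn, ← map_apply_dir, map_flipAt]
    exact c.step (f.map b) (f.dir i)

theorem step_of_eq_false (c : M.Cube n) {b : Fin n → Bool} {i : Fin n} (h : b i = false) :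
    M.step (c.vtx b) (c.dir i) (c.vtx (flipAt b i)) := by
  have := c.step b i
  rwa [h, turn_false] at this

theorem ext_origin {c c' : M.Cube n} (h₀ : c.vtx (fun _ => false) = c'.vtx fun _ => false)
    (hd : c.dir = c'.dir) : c = c' := by
  refine Cube.ext (funext fun b => ?_) hd
  induction b using flipAt_induction with
  | zero => exact h₀
  | flip b i hb ih => exact M.step_det (ih ▸ c.step_of_eq_false hb) (hd ▸ c'.step_of_eq_false hb)

theorem step_vtx {c c' : M.Cube n} (hd : c'.dir = c.dir) {d : T × Bool}
    (indep : ∀ i, A.indep d.1 (c.dir i).1)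
    (step_zero : M.step (c.vtx fun _ => false) d (c'.vtx fun _ => false)) (b : Fin n → Bool) :
    M.step (c.vtx b) d (c'.vtx b) := by
  induction b using flipAt_induction with
  | zero => exact step_zero
  | flip b i hb ih =>
    obtain ⟨u, h', h⟩ := M.diamond (indep i) ih (c.step_of_eq_false hb)
    rwa [M.step_det h' (hd ▸ c'.step_of_eq_false hb)] at h

/-- The cube with opposite faces `c` and `c'` that are joined by steps labelled `d`. -/
def prism (c c' : M.Cube n) (d : T × Bool) (hd : c'.dir = c.dir)
    (indep : ∀ i, A.indep d.1 (c.dir i).1) (step : ∀ b, M.step (c.vtx b) d (c'.vtx b)) :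
    M.Cube (n + 1) where
  vtx b := (if b 0 then c' else c).vtx (Fin.tail b)
  dir := Fin.cons d c.dir
  indep i j := by
    refine Fin.cases (Fin.cases ?_ fun j => ?_) (fun i => Fin.cases ?_ fun j => ?_) i j
    · exact fun h => absurd rfl h
    · exact fun _ => indep j
    · exact fun _ => A.symm (indep i)
    · exact fun h => c.indep i j fun h' => h (congrArg _ h')
  step b i := by
    induction i using Fin.cases with
    | zero =>
      have tail : Fin.tail (flipAt b 0) = Fin.tail b :=
        funext fun j => flipAt_of_ne b j.succ_ne_zero
      cases hb : b 0
      · simpa [tail, hb] using step (Fin.tail b)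
      · simpa [tail, hb] using M.step_inv (step (Fin.tail b))
    | succ j =>
      have tail : Fin.tail (flipAt b j.succ) = flipAt (Fin.tail b) j := by
        funext k
        by_cases hk : k = j
        · subst hk; simp [Fin.tail]
        · rw [flipAt_of_ne _ hk, Fin.tail, flipAt_of_ne _ fun h => hk (Fin.succ_injective _ h),
            Fin.tail]
      rw [tail, flipAt_of_ne b j.succ_ne_zero.symm, Fin.cons_succ]
      cases b 0
      · exact c.step (Fin.tail b) j
      · exact hd ▸ c'.step (Fin.tail b) j

end Cube

theorem exists_cube (v : M.V) (d : Fin n → T × Bool)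
    (indep : ∀ i j, i ≠ j → A.indep (d i).1 (d j).1) (enabled : ∀ i, ∃ w, M.step v (d i) w) :
    ∃ c : M.Cube n, c.vtx (fun _ => false) = v ∧ c.dir = d := by
  induction n generalizing v with
  | zero => exact ⟨⟨fun _ => v, d, indep, fun _ i => i.elim0⟩, rfl, rfl⟩
  | succ n ih =>
    have indep_tail : ∀ i j, i ≠ j → A.indep (Fin.tail d i).1 (Fin.tail d j).1 :=
      fun i j h => indep _ _ fun h' => h (Fin.succ_injective _ h')
    have indep_zero : ∀ i, A.indep (d 0).1 (Fin.tail d i).1 :=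
      fun i => indep _ _ i.succ_ne_zero.symm
    obtain ⟨w, hw⟩ := enabled 0
    have enabled_after : ∀ i, ∃ w', M.step w (Fin.tail d i) w' := fun i => by
      obtain ⟨w', hw'⟩ := enabled i.succ
      obtain ⟨u, hu, -⟩ := M.diamond (indep_zero i) hw hw'
      exact ⟨u, hu⟩
    obtain ⟨c, rfl, hc⟩ := ih v (Fin.tail d) indep_tail fun i => enabled i.succ
    obtain ⟨c', rfl, hc'⟩ := ih w (Fin.tail d) indep_tail enabled_after
    have indep_dir : ∀ i, A.indep (d 0).1 (c.dir i).1 := by rwa [hc]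
    have hd : c'.dir = c.dir := hc'.trans hc.symm
    refine ⟨c.prism c' (d 0) hd indep_dir (Cube.step_vtx hd indep_dir hw), ?_, ?_⟩
    · simp only [Cube.prism, Bool.false_eq_true, if_false]
      rfl
    · simp only [Cube.prism, hc, Fin.cons_self_tail]

variable (M)

/-- The cube complex of a system. -/
def complex : CubeComplex.{u} where
  cube n := M.Cube n
  face f c := c.face f
  face_id n c := by
    refine Cube.ext_origin (congrArg c.vtx (map_id n _)) ?_
    funext i
    exact turn_false _
  face_comp g f c := by
    refine Cube.ext_origin (congrArg c.vtx (map_comp g f _)) ?_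
    funext i
    simp [Cube.face, CubeFace.comp, map_apply_dir]
  free n f c h := by
    have dir_eq (i) : turn (c.dir (f.dir i)) (f.base (f.dir i)) = c.dir i :=
      congrFun (congrArg Cube.dir h) i
    have fix (i) : f.dir i = i := by
      by_contra hi
      have := c.indep _ _ hi
      rw [← dir_eq i] at this
      exact A.irrefl _ this
    refine CubeFace.ext (Function.Embedding.ext fix) (funext fun i => ?_)
    have sign := congrArg Prod.snd (dir_eq i)
    rw [fix] at sign
    cases hb : f.base i
    · rfl
    · simp [turn, hb] at sign

variable {M}

/-- The state at a vertex. -/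
def state (x : M.complex.cube 0) : M.V := Cube.vtx (n := 0) x fun _ => false

/-- The signed letter that labels an oriented edge. -/
def label (e : M.complex.cube 1) : T × Bool := Cube.dir (n := 1) e 0

/-- The vertex with a given state. -/
def vertexAt (v : M.V) : M.complex.cube 0 :=
  (⟨fun _ => v, fun i => i.elim0, fun i => i.elim0, fun _ i => i.elim0⟩ : M.Cube 0)

theorem state_injective : Function.Injective (state (M := M)) := fun _ _ h =>
  Cube.ext_origin h (funext fun i => i.elim0)

@[simp] theorem vertexAt_state (x : M.complex.cube 0) : vertexAt (state x) = x :=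
  state_injective rfl

theorem state_face_vertex (c : M.complex.cube n) (b : Fin n → Bool) :
    state (M.complex.face (CubeFace.vertex b) c) = Cube.vtx (n := n) c b :=
  congrArg (Cube.vtx (n := n) c) (map_false _)

theorem label_originEdge (c : M.complex.cube n) (i : Fin n) :
    label (originEdge c i) = Cube.dir (n := n) c i := turn_false _

theorem label_flip (e : M.complex.cube 1) : label (flip e) = inv (label e) := turn_true _

theorem label_top (s : M.complex.cube 2) : label (top s) = label (bottom s) := rfl

theorem label_right (s : M.complex.cube 2) : label (right s) = label (left s) := rfl

theorem step_edge (e : M.complex.cube 1) :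
    M.step (state (source e)) (label e) (state (target e)) := by
  have h := Cube.step_of_eq_false (n := 1) e (b := fun _ => false) (i := 0) rfl
  rwa [show flipAt (fun _ => false) 0 = fun _ : Fin 1 => true by decide, ← state_face_vertex,
    ← state_face_vertex] at h

theorem complex_cube_ext {c c' : M.complex.cube n} (h₀ : origin c = origin c')
    (h : ∀ i, label (originEdge c i) = label (originEdge c' i)) : c = c' := by
  refine Cube.ext_origin ?_ (funext fun i => ?_)
  · rw [← state_face_vertex, ← state_face_vertex]
    exact congrArg state h₀
  · rw [← label_originEdge, ← label_originEdge, h]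

theorem exists_complex_cube (x : M.complex.cube 0) (d : Fin n → T × Bool)
    (indep : ∀ i j, i ≠ j → A.indep (d i).1 (d j).1)
    (enabled : ∀ i, ∃ w, M.step (state x) (d i) w) :
    ∃ c : M.complex.cube n, origin c = x ∧ ∀ i, label (originEdge c i) = d i := by
  obtain ⟨c, h₀, hd⟩ := exists_cube (state x) d indep enabled
  exact ⟨c, state_injective ((state_face_vertex (n := n) c _).trans h₀), fun i =>
    (label_originEdge (n := n) c i).trans (congrFun hd i)⟩

theorem edge_ext {e e' : M.complex.cube 1} (h : source e = source e') (hl : label e = label e') :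
    e = e' := by
  refine complex_cube_ext h fun i => ?_
  rw [Subsingleton.elim i 0, label_originEdge, label_originEdge]
  exact hl

theorem exists_edge {x : M.complex.cube 0} {d : T × Bool} {w : M.V} (h : M.step (state x) d w) :
    ∃ e : M.complex.cube 1, source e = x ∧ label e = d ∧ state (target e) = w := by
  obtain ⟨e, rfl, hd⟩ := exists_complex_cube (n := 1) x (fun _ => d)
    (fun i j h => absurd (Subsingleton.elim i j) h) fun _ => ⟨w, h⟩
  have hl : label e = d := (label_originEdge e 0).symm.trans (hd 0)
  exact ⟨e, rfl, hl, M.step_det (hl ▸ step_edge e) h⟩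

theorem indep_square (s : M.complex.cube 2) : A.indep (label (bottom s)).1 (label (left s)).1 :=
  Cube.indep (n := 2) s 0 1 (by decide)

theorem indep_of_formCorner {e e' : M.complex.cube 1} (h : FormCorner e e') :
    A.indep (label e).1 (label e').1 := by
  obtain ⟨s, rfl, rfl⟩ := h
  exact indep_square s

theorem formCorner_of_indep {e e' : M.complex.cube 1} (h : source e = source e')
    (hI : A.indep (label e).1 (label e').1) : FormCorner e e' := by
  obtain ⟨s, h₀, hd⟩ := exists_complex_cube (source e) ![label e, label e']
    (by simpa [Fin.forall_fin_two] using ⟨hI, A.symm hI⟩)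
    (by simpa [Fin.forall_fin_two] using ⟨⟨_, step_edge e⟩, ⟨_, h ▸ step_edge e'⟩⟩)
  have origin_eq : (![false, false] : Fin 2 → Bool) = fun _ => false := by decide
  refine ⟨s, edge_ext ?_ (hd 0), edge_ext ?_ (hd 1)⟩
  · rw [bottom, origin_eq]
    exact (source_originEdge s 0).trans h₀
  · rw [left, origin_eq]
    exact ((source_originEdge s 1).trans h₀).trans h

/-! ### Nonpositive curvature and specialness -/

variable (M)

theorem isNPC_complex : M.complex.IsNPC where
  link_nondegenerate s h := by
    have := indep_square s
    rw [h] at this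
    exact A.irrefl _ this
  link_simplicial d c c' h₀ h := complex_cube_ext h₀ fun i => congrArg label (h i)
  link_flag d v e hv hc := by
    obtain ⟨c, h₀, hd⟩ := exists_complex_cube v (fun i => label (e i))
      (fun i j h => indep_of_formCorner (hc i j h)) fun i => ⟨_, hv i ▸ step_edge (e i)⟩
    exact ⟨c, h₀, fun i => edge_ext (by rw [source_originEdge, h₀, hv]) (hd i)⟩

variable {M}

theorem label_eq_of_orientedParallel {e e' : M.complex.cube 1}
    (h : M.complex.OrientedParallel e e') : label e = label e' := by
  induction h with
  | rel x y h => obtain ⟨s, rfl, rfl⟩ := h; exact (label_top s).symm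
  | refl x => rfl
  | symm x y _ ih => exact ih.symm
  | trans x y z _ _ ih ih' => exact ih.trans ih'

/-- The letter that labels the edges dual to a hyperplane, up to sign. -/
def hyperplaneLabel : M.complex.Hyperplane → T :=
  Quot.lift (fun e => (label e).1) (by
    rintro e e' (rfl | ⟨s, rfl, rfl⟩)
    · rw [label_flip]; rfl
    · rw [label_top])

theorem indep_of_intersect {H H' : M.complex.Hyperplane} (h : H.Intersect H') :
    A.indep (hyperplaneLabel H) (hyperplaneLabel H') := by
  obtain ⟨s, rfl, rfl⟩ := h
  exact indep_square s

variable (M)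

theorem isSpecial_complex : M.complex.IsSpecial where
  two_sided H e _ h := by
    have := congrArg Prod.snd (label_eq_of_orientedParallel h)
    simp [label_flip, inv] at this
  not_selfIntersects H h := A.irrefl _ (indep_of_intersect h)
  not_directlySelfOsculates H := by
    rintro ⟨e₁, e₂, hs, hne, -, -, -, hp⟩
    exact hne (edge_ext hs (label_eq_of_orientedParallel hp))
  not_interOsculate H₁ H₂ _ := by
    rintro ⟨h, e₁, e₂, hs, -, -, hc, rfl, rfl⟩
    exact hc (formCorner_of_indep hs (indep_of_intersect h))

variable {M} in
theorem Cube.dim_le [Finite T] (c : M.Cube n) : n ≤ Nat.card T := by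
  have inj : Function.Injective fun i => (c.dir i).1 := fun i j (h : (c.dir i).1 = _) => by
    by_contra hij
    exact A.irrefl _ (h ▸ c.indep i j hij)
  simpa using Nat.card_le_card_of_injective _ inj

theorem isFinite_complex [Finite T] [Finite M.V] : M.complex.IsFinite := by
  have finite_cube (n) : Finite (M.Cube n) :=
    Finite.of_injective (fun c : M.Cube n => (c.vtx, c.dir)) fun c c' h =>
      Cube.ext (congrArg Prod.fst h) (congrArg Prod.snd h)
  refine Finite.of_surjective
    (fun c : Σ k : Fin (Nat.card T + 1), M.Cube k => (⟨c.1, c.2⟩ : Σ n, M.complex.cube n)) ?_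
  rintro ⟨n, c⟩
  exact ⟨⟨⟨n, Nat.lt_succ_of_le (Cube.dim_le c)⟩, c⟩, rfl⟩

/-- The orientation of the edges by the signs of their labels. -/
def orientation : M.complex.AdmissibleOrientation where
  pos e := (label e).2 = true
  pos_flip e := by rw [label_flip]; simp [inv]
  pos_parallel s := by rw [label_top]

/-- One state can be reached from another by steps with positive labels. -/
def PosReach : M.V → M.V → Prop := Relation.ReflTransGen fun v w => ∃ t, M.step v (t, true) w

variable {M}

theorem reach_orientation {x y : M.complex.cube 0} :
    M.orientation.Reach x y ↔ M.PosReach (state x) (state y) := by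
  constructor
  · refine Relation.ReflTransGen.lift state ?_ x y
    rintro _ _ ⟨e, he, rfl, rfl⟩
    have step := step_edge e
    rw [show label e = ((label e).1, true) from Prod.ext rfl he] at step
    exact ⟨_, step⟩
  · intro h
    rw [← vertexAt_state x, ← vertexAt_state y]
    refine Relation.ReflTransGen.lift vertexAt ?_ _ _ h
    rintro v _ ⟨t, h⟩
    obtain ⟨e, hs, hl, rfl⟩ := exists_edge (x := vertexAt v) h
    exact ⟨e, congrArg Prod.snd hl, hs, (vertexAt_state _).symm⟩

/-! ### Coverings and components -/

variable {M' : ReversibleSystem A}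

/-- The map of complexes induced by a map of states that respects steps. -/
def homOfStep (p : M'.V → M.V) (hp : ∀ {v d w}, M'.step v d w → M.step (p v) d (p w)) :
    Hom M'.complex M.complex where
  map {n} c := (⟨fun b => p (Cube.vtx (n := n) c b), Cube.dir (n := n) c,
    Cube.indep (n := n) c, fun b i => hp (Cube.step (n := n) c b i)⟩ : M.Cube n)
  map_face _ _ := rfl

theorem isCovering_homOfStep (p : M'.V → M.V)
    (hp : ∀ {v d w}, M'.step v d w → M.step (p v) d (p w)) (surj : Function.Surjective p)
    (lift : ∀ {v d w}, M.step (p v) d w → ∃ w', M'.step v d w') :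
    (homOfStep p hp).IsCovering := by
  have star : ∀ (n : ℕ) (y : M'.complex.cube 0) (c : M.complex.cube n),
      origin c = (homOfStep p hp).map y →
        ∃! d : M'.complex.cube n, origin d = y ∧ (homOfStep p hp).map d = c := by
    intro n y c h
    have enabled (i) : ∃ w, M'.step (state y) (label (originEdge c i)) w := by
      have step := step_edge (originEdge c i)
      rw [source_originEdge, h] at step
      exact lift step
    obtain ⟨d, rfl, hd⟩ := exists_complex_cube y (fun i => label (originEdge c i))
      (fun i j hij => by
        rw [label_originEdge, label_originEdge]
        exact Cube.indep (n := n) c i j hij) enabled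
    have label_map (d : M'.complex.cube n) (i) :
        label (originEdge ((homOfStep p hp).map d) i) = label (originEdge d i) := rfl
    refine ⟨d, ⟨rfl, complex_cube_ext h.symm hd⟩,
      fun d' ⟨h₀, h'⟩ => complex_cube_ext h₀ fun i => ?_⟩
    rw [hd, ← h', label_map]
  refine ⟨fun n c => ?_, star⟩
  obtain ⟨v, hv⟩ := surj (state (origin c))
  obtain ⟨d, ⟨-, h⟩, -⟩ := star n (vertexAt v) c (state_injective hv.symm)
  exact ⟨d, h⟩

theorem isVirtuallySpecial_complex [Finite T] [Finite M.V] : M.complex.IsVirtuallySpecial :=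
  ⟨M.isFinite_complex, M.isNPC_complex, M.complex, homOfStep _root_.id _root_.id,
    M.isFinite_complex, M.isNPC_complex, M.isSpecial_complex,
    isCovering_homOfStep _ _ Function.surjective_id fun h => ⟨_, h⟩⟩

variable (M)

/-- One state can be reached from another by steps. -/
def Connected : M.V → M.V → Prop := Relation.ReflTransGen fun v w => ∃ d, M.step v d w

/-- The restriction of the system to the states that can be reached from `v₀`. -/
def component (v₀ : M.V) : ReversibleSystem A where
  V := {v : M.V // M.Connected v₀ v}
  step v d w := M.step v.1 d w.1
  step_inv h := M.step_inv h
  step_det h h' := Subtype.ext (M.step_det h h')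
  diamond {_ _ _ w _} hI h h' := by
    obtain ⟨u, hu, hu'⟩ := M.diamond hI h h'
    exact ⟨⟨u, w.2.tail ⟨_, hu⟩⟩, hu, hu'⟩

variable {M}

theorem connected_component {v₀ : M.V} (v : (M.component v₀).V) :
    (M.component v₀).Connected ⟨v₀, .refl⟩ v := by
  obtain ⟨v, hv⟩ := v
  induction hv with
  | refl => exact .refl
  | tail _ h ih =>
    obtain ⟨d, h⟩ := h
    exact ih.tail ⟨d, h⟩

theorem PosReach.connected {v w : M.V} (h : M.PosReach v w) : M.Connected v w :=
  Relation.ReflTransGen.mono (fun _ _ ⟨t, h⟩ => ⟨(t, true), h⟩) _ _ h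

theorem posReach_component {v₀ : M.V} {v w : (M.component v₀).V} :
    (M.component v₀).PosReach v w ↔ M.PosReach v.1 w.1 := by
  refine ⟨fun h => Relation.ReflTransGen.lift
    (p := fun v w => ∃ t, M.step v (t, true) w) Subtype.val (fun _ _ h => h) _ _ h, fun h => ?_⟩
  obtain ⟨w, hw⟩ := w
  change M.PosReach v.1 w at h
  induction h with
  | refl => exact .refl
  | tail h step ih => exact (ih (v.2.trans (PosReach.connected h))).tail step

end ReversibleSystem

namespace ReversibleSystem

open SignedLetter IndependenceAlphabet CubeComplex

variable {T : Type u} {A : IndependenceAlphabet T} {M : ReversibleSystem A}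
  {x y z : M.complex.cube 0} {p q : List (M.complex.cube 1)} {w : List (T × Bool)}

/-! ### The universal cover -/

theorem path_ext (hp : IsPath x p y) (hq : IsPath x q z) (h : p.map label = q.map label) :
    p = q := by
  induction p generalizing x q with
  | nil => simpa using h.symm
  | cons e p ih =>
    cases q with
    | nil => simp at h
    | cons e' q =>
      simp only [List.map_cons, List.cons.injEq] at h
      obtain ⟨rfl, hp⟩ := hp
      obtain ⟨hs, hq⟩ := hq
      obtain rfl : e = e' := edge_ext hs.symm h.1
      rw [ih hp hq h.2]

theorem exists_square {e e' : M.complex.cube 1} (h : target e = source e')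
    (hI : A.indep (label e).1 (label e').1) : ∃ s, bottom s = e ∧ right s = e' := by
  have step' := step_edge e'
  rw [← h] at step'
  obtain ⟨_, enabled, -⟩ := M.diamond (d := inv (label e)) hI (M.step_inv (step_edge e)) step'
  obtain ⟨e'', hs, hl, -⟩ := exists_edge enabled
  obtain ⟨s, rfl, rfl⟩ := formCorner_of_indep hs.symm (by rwa [hl])
  exact ⟨s, rfl, edge_ext ((source_right s).trans h) ((label_right s).trans hl)⟩

theorem exists_homotopic_of_swap (hp : IsPath x p y) (h : A.Swap (p.map label) w) :
    ∃ q, q.map label = w ∧ PathHomotopic x y p q := by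
  obtain ⟨w₁, w₂, d, d', hI, hw, rfl⟩ := h
  obtain ⟨_, p₂, rfl, hw₁, rfl⟩ := List.map_eq_append_iff.1 hw
  obtain ⟨p₁, _, rfl, rfl, hw₂⟩ := List.map_eq_append_iff.1 hw₁
  obtain ⟨e, _, rfl, rfl, hw₃⟩ := List.map_eq_cons_iff.1 hw₂
  obtain ⟨e', _, rfl, rfl, hw₄⟩ := List.map_eq_cons_iff.1 hw₃
  obtain rfl := List.map_eq_nil_iff.1 hw₄
  obtain ⟨v₂, h₁₂, h₂⟩ := isPath_append.1 hp
  obtain ⟨v₁, h₁, rfl, he', rfl⟩ := isPath_append.1 h₁₂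
  obtain ⟨s, rfl, rfl⟩ := exists_square he'.symm hI
  have sides : IsPath (source (bottom s)) [left s, top s] (target (right s)) :=
    ⟨source_left s, source_top s, target_top s⟩
  exact ⟨p₁ ++ [left s, top s] ++ p₂, by simp [label_top, label_right],
    .of_elemHomotopy hp ((h₁.append sides).append h₂) (.inr ⟨p₁, p₂, s, rfl, rfl⟩)⟩

theorem exists_homotopic_of_swapEq (hp : IsPath x p y) (h : A.SwapEq (p.map label) w) :
    ∃ q, q.map label = w ∧ PathHomotopic x y p q := by
  induction h with
  | refl => exact ⟨p, rfl, .refl hp⟩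
  | tail _ h ih =>
    obtain ⟨q, rfl, hq⟩ := ih
    obtain ⟨q', hl, hq'⟩ := exists_homotopic_of_swap hq.isPath_right h
    exact ⟨q', hl, hq.trans hq'⟩

theorem pathHomotopic_of_swapEq (hp : IsPath x p y) (hq : IsPath x q y)
    (h : A.SwapEq (p.map label) (q.map label)) : PathHomotopic x y p q := by
  obtain ⟨q', hl, hq'⟩ := exists_homotopic_of_swapEq hp h
  rwa [path_ext hq'.isPath_right hq hl] at hq'

theorem exists_homotopic_of_isTop (hp : IsPath x p y) {e : M.complex.cube 1} (he : source e = y)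
    (h : IsTop (inv (label e)) (A.pile (p.map label))) :
    ∃ q, PathHomotopic x (target e) (p ++ [e]) q ∧
      A.pile (q.map label) = A.pop (label e).1 (A.pile (p.map label)) := by
  obtain ⟨u, hu⟩ := exists_swapEq_concat h
  obtain ⟨p', hl, hp'⟩ := exists_homotopic_of_swapEq hp hu
  obtain ⟨q, _, rfl, rfl, hd⟩ := List.map_eq_append_iff.1 hl
  obtain ⟨e', _, rfl, hl', hnil⟩ := List.map_eq_cons_iff.1 hd
  obtain rfl := List.map_eq_nil_iff.1 hnil
  obtain ⟨z, -, -, ht⟩ := isPath_append.1 hp'.isPath_right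
  obtain rfl : flip e' = e :=
    edge_ext ((source_flip e').trans (Eq.trans ht he.symm)) (by rw [label_flip, hl', inv_inv])
  have extend : PathHomotopic x (target (flip e')) (p ++ [flip e']) (q ++ [e', flip e']) := by
    simpa using hp'.append_right (isPath_singleton.2 ⟨he, rfl⟩)
  refine ⟨q, extend.trans (.backtrack extend.isPath_right), ?_⟩
  rw [hu.pile_eq, pile_concat]
  exact (pop_push (inv (label (flip e'))) _).symm

theorem exists_homotopic_pile_eq (f : M.V → T → List (Option Bool))
    (hx : f (state x) = fun _ => []) (hf : ∀ {v d w}, M.step v d w → f w = A.act d (f v))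
    (hp : IsPath x p y) : ∃ q, PathHomotopic x y p q ∧ A.pile (q.map label) = f (state y) := by
  induction p using List.reverseRecOn generalizing y with
  | nil =>
    obtain rfl : x = y := hp
    exact ⟨[], .refl rfl, hx.symm⟩
  | append_singleton p e ih =>
    obtain ⟨y, hpy, he, rfl⟩ := isPath_append.1 hp
    obtain ⟨q, hpq, hq⟩ := ih hpy
    have extend := hpq.append_right (isPath_singleton.2 ⟨he, rfl⟩)
    rw [hf (step_edge e), he, ← hq]
    by_cases h : IsTop (inv (label e)) (A.pile (q.map label))
    · obtain ⟨q', hq', hpile⟩ := exists_homotopic_of_isTop hpq.isPath_right he h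
      exact ⟨q', extend.trans hq', hpile.trans (act_of_isTop h).symm⟩
    · refine ⟨q ++ [e], extend, ?_⟩
      rw [List.map_append, List.map_singleton, pile_concat, act_of_not_isTop h]

theorem exists_isPath_of_connected {v w : M.V} (h : M.Connected v w) :
    ∃ p, IsPath (vertexAt v) p (vertexAt w) := by
  induction h with
  | refl => exact ⟨[], rfl⟩
  | tail _ h ih =>
    obtain ⟨p, hp⟩ := ih
    obtain ⟨d, h⟩ := h
    obtain ⟨e, hs, -, rfl⟩ := exists_edge (x := vertexAt _) h
    exact ⟨p ++ [e], hp.append ⟨hs, (vertexAt_state _).symm⟩⟩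

/-- Every path is homotopic to one whose word has the piling of its end as piling. Two words with
the same piling are trace equivalent, so paths with the same end are homotopic. -/
theorem isSimplyConnected_of_piling (f : M.V → T → List (Option Bool)) {v₀ : M.V}
    (h₀ : f v₀ = fun _ => []) (hf : ∀ {v d w}, M.step v d w → f w = A.act d (f v))
    (connected : ∀ v, M.Connected v₀ v) : M.complex.IsSimplyConnected := by
  refine isSimplyConnected_of_pathHomotopic (vertexAt v₀) (fun y => ?_) fun y p q hp hq => ?_
  · rw [← vertexAt_state y]
    exact exists_isPath_of_connected (connected _)
  · obtain ⟨p', hpp', hp'⟩ := exists_homotopic_pile_eq f (x := vertexAt v₀) h₀ hf hp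
    obtain ⟨q', hqq', hq'⟩ := exists_homotopic_pile_eq f (x := vertexAt v₀) h₀ hf hq
    exact (hpp'.trans (pathHomotopic_of_swapEq hpp'.isPath_right hqq'.isPath_right
      (swapEq_of_pile_eq (hp'.trans hq'.symm)))).trans hqq'.symm

variable (M)

/-- The product of a system with the right-angled Artin group of its alphabet, on which steps act
by multiplication with their labels. -/
def unfolding : ReversibleSystem A where
  V := M.V × {r // A.IsReduced r}
  step v d w := M.step v.1 d w.1 ∧ w.2.1 = A.act d v.2.1
  step_inv {v d w} h := ⟨M.step_inv h.1, by rw [h.2, v.2.2.act_inv_act]⟩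
  step_det h h' := Prod.ext (M.step_det h.1 h'.1) (Subtype.ext (h.2.trans h'.2.symm))
  diamond {v d d' w w'} hI h h' := by
    obtain ⟨u, hu, hu'⟩ := M.diamond hI h.1 h'.1
    refine ⟨⟨u, A.act d' w.2.1, w.2.2.act d'⟩, ⟨hu, rfl⟩, hu', ?_⟩
    change A.act d' w.2.1 = _
    rw [h.2, h'.2, v.2.2.act_comm hI]

/-- The state of the unfolding over `v₀` with the empty piling. -/
def root (v₀ : M.V) : M.unfolding.V := (v₀, ⟨_, isReduced_nil⟩)

/-- The component of the unfolding over `v₀`; it is the universal cover of the component of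
`v₀`. -/
def cover (v₀ : M.V) : ReversibleSystem A := M.unfolding.component (M.root v₀)

variable {M}

theorem Connected.fst {v w : M.unfolding.V} (h : M.unfolding.Connected v w) :
    M.Connected v.1 w.1 :=
  Relation.ReflTransGen.lift (p := fun v w => ∃ d, M.step v d w) Prod.fst
    (fun _ _ h' => h'.imp fun _ h => h.1) _ _ h

theorem exists_cover_step {v₀ : M.V} (v : (M.cover v₀).V) {d : T × Bool} {w : M.V}
    (h : M.step v.1.1 d w) : ∃ w' : (M.cover v₀).V, (M.cover v₀).step v d w' ∧ w'.1.1 = w :=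
  ⟨⟨⟨w, A.act d v.1.2.1, v.1.2.2.act d⟩, v.2.tail ⟨d, h, rfl⟩⟩, ⟨h, rfl⟩, rfl⟩

variable (M)

/-- The covering map from the component of the unfolding. -/
def coverHom (v₀ : M.V) : Hom (M.cover v₀).complex (M.component v₀).complex :=
  homOfStep (M := M.component v₀) (M' := M.cover v₀) (fun v => ⟨v.1.1, v.2.fst⟩) fun h => h.1

theorem isUniversalCover_coverHom (v₀ : M.V) : (M.coverHom v₀).IsUniversalCover where
  covering := by
    refine isCovering_homOfStep (M := M.component v₀) (M' := M.cover v₀) (fun v => ⟨v.1.1, v.2.fst⟩)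
      (fun h => h.1) ?_ fun h => ?_
    · rintro ⟨v, hv⟩
      induction hv with
      | refl => exact ⟨⟨_, .refl⟩, rfl⟩
      | tail _ h ih =>
        obtain ⟨v, hv⟩ := ih
        obtain ⟨d, h⟩ := h
        obtain rfl := congrArg Subtype.val hv
        obtain ⟨w, -, rfl⟩ := exists_cover_step v h
        exact ⟨w, rfl⟩
    · obtain ⟨w, hw, -⟩ := exists_cover_step _ h
      exact ⟨w, hw⟩
  simply_connected :=
    isSimplyConnected_of_piling (M := M.cover v₀) (fun v => v.1.2.1)
      (v₀ := ⟨M.root v₀, .refl⟩) rfl (fun h => h.2) connected_component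

theorem lift_orientation (v₀ : M.V) :
    (M.component v₀).orientation.lift (M.coverHom v₀) = (M.cover v₀).orientation := rfl

end ReversibleSystem

/-! ### Configurations and views -/

namespace EventStructure

open scoped Classical

variable {E : Type u} [PartialOrder E] {S : EventStructure E} {c d : Finset E} {e f : E}

theorem IsConfiguration.not_conflict (hc : S.IsConfiguration c) (he : e ∈ c) (hf : f ∈ c) :
    ¬ S.conflict e f := hc.1 e he f hf

theorem IsConfiguration.mem_of_le (hc : S.IsConfiguration c) (he : e ∈ c) (h : f ≤ e) : f ∈ c :=
  hc.2 e he f h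

variable (S) in
/-- The event `e` is enabled at the configuration `c`: it can be added to `c`. -/
structure Enabled (c : Finset E) (e : E) : Prop where
  notMem : e ∉ c
  not_conflict : ∀ f ∈ c, ¬ S.conflict f e
  mem_of_lt : ∀ {f}, f < e → f ∈ c

variable (S) in
/-- The least configuration that contains `e`. -/
noncomputable def causes (e : E) : Finset E := (S.finite_causes e).toFinset

variable (S) in
/-- The least configuration at which `e` is enabled. -/
noncomputable def past (e : E) : Finset E := (S.causes e).erase e

theorem mem_causes : f ∈ S.causes e ↔ f ≤ e := by simp [causes]

theorem mem_past : f ∈ S.past e ↔ f < e := by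
  simp [past, mem_causes, lt_iff_le_and_ne, and_comm]

theorem insert_past (e : E) : insert e (S.past e) = S.causes e :=
  Finset.insert_erase (mem_causes.2 le_rfl)

theorem isConfiguration_empty : S.IsConfiguration ∅ := by simp [IsConfiguration]

theorem isConfiguration_causes (e : E) : S.IsConfiguration (S.causes e) := by
  refine ⟨fun f hf g hg h => ?_, fun _ hf _ hg => mem_causes.2 (hg.trans (mem_causes.1 hf))⟩
  have conflict_e : S.conflict e f :=
    S.conflict_symm _ _ (S.conflict_inherit _ _ _ h (mem_causes.1 hg))
  exact S.conflict_irrefl _ (S.conflict_inherit _ _ _ conflict_e (mem_causes.1 hf))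

theorem IsConfiguration.of_subset (hc : S.IsConfiguration c) (h : d ⊆ c)
    (hd : ∀ e ∈ d, ∀ f ≤ e, f ∈ d) : S.IsConfiguration d :=
  ⟨fun _ he _ hf => hc.not_conflict (h he) (h hf), hd⟩

theorem isConfiguration_past (e : E) : S.IsConfiguration (S.past e) :=
  (isConfiguration_causes e).of_subset (Finset.erase_subset _ _) fun _ hf _ hg =>
    mem_past.2 (hg.trans_lt (mem_past.1 hf))

theorem enabled_past (e : E) : S.Enabled (S.past e) e where
  notMem := Finset.notMem_erase _ _
  not_conflict _ hf := (isConfiguration_causes e).not_conflict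
    (mem_causes.2 (mem_past.1 hf).le) (mem_causes.2 le_rfl)
  mem_of_lt := mem_past.2

protected theorem IsConfiguration.insert (hc : S.IsConfiguration c) (he : S.Enabled c e) :
    S.IsConfiguration (insert e c) := by
  constructor
  · intro f hf g hg h
    rw [Finset.mem_insert] at hf hg
    rcases hf with rfl | hf <;> rcases hg with rfl | hg
    · exact S.conflict_irrefl _ h
    · exact he.not_conflict g hg (S.conflict_symm _ _ h)
    · exact he.not_conflict f hf h
    · exact hc.not_conflict hf hg h
  · intro f hf g hg
    rw [Finset.mem_insert] at hf ⊢
    rcases hf with rfl | hf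
    · exact hg.eq_or_lt.imp_right he.mem_of_lt
    · exact .inr (hc.mem_of_le hf hg)

theorem enabled_erase (hc : S.IsConfiguration c) (he : Maximal (· ∈ c) e) :
    S.IsConfiguration (c.erase e) ∧ S.Enabled (c.erase e) e where
  left := hc.of_subset (Finset.erase_subset _ _) fun f hf g hg => by
    obtain ⟨hfe, hfc⟩ := Finset.mem_erase.1 hf
    refine Finset.mem_erase.2 ⟨?_, hc.mem_of_le hfc hg⟩
    rintro rfl
    exact hfe (he.eq_of_ge hfc hg)
  right :=
    { notMem := Finset.notMem_erase _ _
      not_conflict f hf := hc.not_conflict (Finset.mem_of_mem_erase hf) he.prop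
      mem_of_lt hf := Finset.mem_erase.2 ⟨hf.ne, hc.mem_of_le he.prop hf.le⟩ }

theorem IsConfiguration.induction_of_subset (hc : S.IsConfiguration c)
    {P : ∀ d, S.IsConfiguration d → Prop} (base : P c hc)
    (insert : ∀ d e (hd : S.IsConfiguration d) (he : S.Enabled d e), c ⊆ d → P d hd →
      P (insert e d) (hd.insert he))
    (hd : S.IsConfiguration d) (hcd : c ⊆ d) : P d hd := by
  induction d using Finset.strongInduction with
  | H d ih =>
    rcases (d \ c).eq_empty_or_nonempty with h | hne
    · obtain rfl := (Finset.sdiff_eq_empty_iff_subset.1 h).antisymm hcd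
      exact base
    · obtain ⟨e, he⟩ := (d \ c).exists_maximal hne
      obtain ⟨hed, hec⟩ := Finset.mem_sdiff.1 he.prop
      have maximal : Maximal (· ∈ d) e := ⟨hed, fun f hf hef =>
        he.2 (Finset.mem_sdiff.2 ⟨hf, fun hfc => hec (hc.mem_of_le hfc hef)⟩) hef⟩
      obtain ⟨hd', hed'⟩ := enabled_erase hd maximal
      have hcd' : c ⊆ d.erase e := Finset.subset_erase.2 ⟨hcd, hec⟩
      have step := insert _ e hd' hed' hcd' (ih _ (Finset.erase_ssubset hed) hd' hcd')
      simpa only [Finset.insert_erase hed] using step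

@[elab_as_elim]
theorem IsConfiguration.induction {P : ∀ c, S.IsConfiguration c → Prop}
    (empty : P ∅ isConfiguration_empty)
    (insert : ∀ c e (hc : S.IsConfiguration c) (he : S.Enabled c e), P c hc →
      P (insert e c) (hc.insert he)) (hc : S.IsConfiguration c) : P c hc :=
  isConfiguration_empty.induction_of_subset empty (fun c e hc he _ => insert c e hc he) hc
    (Finset.empty_subset c)

theorem wellFoundedLT (S : EventStructure E) : WellFoundedLT E :=
  StrictMono.wellFoundedLT (f := fun e => (S.causes e).card) fun e f h =>
    Finset.card_lt_card <| Finset.ssubset_iff_subset_ne.2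
      ⟨fun _ hg => mem_causes.2 ((mem_causes.1 hg).trans h.le), fun heq =>
        (mem_causes.1 (heq ▸ mem_causes.2 le_rfl : f ∈ S.causes e)).not_gt h⟩

variable {L : Type} {lab : E → L} {B B' : Set L} {g : L} {m : E}

variable (lab) in
/-- The view of the letters `B` on the configuration `c`: the least configuration that contains the
events of `c` with labels in `B`. -/
noncomputable def view (B : Set L) (c : Finset E) : Finset E :=
  c.filter fun e => ∃ f ∈ c, lab f ∈ B ∧ e ≤ f

variable (lab) in
/-- The last event of `c` with label `g`, if there is one. -/
noncomputable def last (g : L) (c : Finset E) : Option E :=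
  if h : ∃ m, IsGreatest {f | f ∈ c ∧ lab f = g} m then some h.choose else none

theorem mem_view : e ∈ view lab B c ↔ e ∈ c ∧ ∃ f ∈ c, lab f ∈ B ∧ e ≤ f := Finset.mem_filter

theorem view_subset (B : Set L) (c : Finset E) : view lab B c ⊆ c := Finset.filter_subset _ _

theorem mem_view_of_mem (h : e ∈ c) (he : lab e ∈ B) : e ∈ view lab B c :=
  mem_view.2 ⟨h, e, h, he, le_rfl⟩

theorem last_eq_some : last lab g c = some m ↔ IsGreatest {f | f ∈ c ∧ lab f = g} m := by
  unfold last
  split_ifs with h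
  · rw [Option.some.injEq]
    exact ⟨fun hm => hm ▸ h.choose_spec, h.choose_spec.unique⟩
  · simpa using fun hm => h ⟨m, hm⟩

protected theorem IsConfiguration.view (hc : S.IsConfiguration c) (B : Set L) :
    S.IsConfiguration (view lab B c) :=
  hc.of_subset (view_subset B c) fun e he f hfe => by
    obtain ⟨hec, k, hk, hkB, hek⟩ := mem_view.1 he
    exact mem_view.2 ⟨hc.mem_of_le hec hfe, k, hk, hkB, hfe.trans hek⟩

theorem view_mono (h : c ⊆ d) : view lab B c ⊆ view lab B d := fun e he => by
  obtain ⟨hec, f, hf, hfB, hef⟩ := mem_view.1 he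
  exact mem_view.2 ⟨h hec, f, h hf, hfB, hef⟩

theorem view_eq_of_subset (hd : d ⊆ c) (h : view lab B c ⊆ d) : view lab B d = view lab B c := by
  refine (view_mono hd).antisymm fun e he => ?_
  obtain ⟨-, f, hf, hfB, hef⟩ := mem_view.1 he
  exact mem_view.2 ⟨h he, f, h (mem_view_of_mem hf hfB), hfB, hef⟩

theorem view_view (h : B ⊆ B') : view lab B (view lab B' c) = view lab B c :=
  view_eq_of_subset (view_subset B' c) fun e he => by
    obtain ⟨hec, f, hf, hfB, hef⟩ := mem_view.1 he
    exact mem_view.2 ⟨hec, f, hf, h hfB, hef⟩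

theorem view_empty (c : Finset E) : view lab ∅ c = ∅ := by
  ext e
  simp [mem_view]

theorem view_union (B B' : Set L) (c : Finset E) :
    view lab (B ∪ B') c = view lab B c ∪ view lab B' c := by
  ext e
  simp only [mem_view, Finset.mem_union, Set.mem_union]
  grind

theorem last_view_of_mem (hg : g ∈ B) (c : Finset E) :
    last lab g (view lab B c) = last lab g c := by
  have same : {f | f ∈ view lab B c ∧ lab f = g} = {f | f ∈ c ∧ lab f = g} := by
    ext f
    exact and_congr_left fun hf => ⟨fun h => view_subset B c h, fun h =>
      mem_view_of_mem h (hf ▸ hg)⟩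
  ext m
  rw [last_eq_some, last_eq_some, same]

theorem view_singleton_eq_causes (hc : S.IsConfiguration c) (h : last lab g c = some e) :
    view lab {g} c = S.causes e := by
  obtain ⟨⟨hec, rfl⟩, greatest⟩ := last_eq_some.1 h
  ext f
  rw [mem_view, mem_causes]
  constructor
  · rintro ⟨-, k, hk, hke, hfk⟩
    exact hfk.trans (greatest ⟨hk, hke⟩)
  · exact fun hfe => ⟨hc.mem_of_le hec hfe, e, hec, rfl, hfe⟩

namespace IsTraceLabeling

variable {A : IndependenceAlphabet L} (H : S.IsTraceLabeling lab A.indep)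
include H

theorem comparable (hc : S.IsConfiguration c) (he : e ∈ c) (hf : f ∈ c)
    (h : ¬ A.indep (lab e) (lab f)) : e ≤ f ∨ f ≤ e := by
  rcases H.les3 e f h with h | h | h
  · exact .inl h
  · exact .inr h
  · exact absurd h (hc.not_conflict he hf)

theorem comparable_of_eq (hc : S.IsConfiguration c) (he : e ∈ c) (hf : f ∈ c)
    (h : lab e = lab f) : e ≤ f ∨ f ≤ e := H.comparable hc he hf (h ▸ A.irrefl _)

theorem exists_last (hc : S.IsConfiguration c) (he : e ∈ c) :
    ∃ m, last lab (lab e) c = some m ∧ e ≤ m := by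
  obtain ⟨m, hem, hm⟩ := (c.filter fun f => lab f = lab e).exists_le_maximal
    (Finset.mem_filter.2 ⟨he, rfl⟩)
  obtain ⟨hmc, hme⟩ := Finset.mem_filter.1 hm.prop
  refine ⟨m, last_eq_some.2 ⟨⟨hmc, hme⟩, fun f ⟨hf, hfe⟩ => ?_⟩, hem⟩
  exact (H.comparable_of_eq hc hf hmc (hfe.trans hme.symm)).elim id
    (hm.2 (Finset.mem_filter.2 ⟨hf, hfe⟩))

theorem mem_view_iff (hc : S.IsConfiguration c) :
    e ∈ view lab B c ↔ ∃ g ∈ B, ∃ m, last lab g c = some m ∧ e ≤ m := by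
  rw [mem_view]
  constructor
  · rintro ⟨-, f, hf, hfB, hef⟩
    obtain ⟨m, hm, hfm⟩ := H.exists_last hc hf
    exact ⟨_, hfB, m, hm, hef.trans hfm⟩
  · rintro ⟨g, hg, m, hm, hem⟩
    obtain ⟨⟨hmc, rfl⟩, -⟩ := last_eq_some.1 hm
    exact ⟨hc.mem_of_le hmc hem, m, hmc, hg, hem⟩

theorem last_view_of_maximal (hc : S.IsConfiguration c)
    (hm : Maximal (fun k => k ∈ view lab B c ∧ k ∈ view lab B' c) m) :
    last lab (lab m) (view lab B c) = some m := by
  have := S.wellFoundedLT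
  obtain ⟨⟨hmB, hmB'⟩, maximal⟩ := hm
  refine last_eq_some.2 ⟨⟨hmB, rfl⟩, fun k ⟨hk, hkm⟩ => ?_⟩
  have hkc := view_subset _ _ hk
  refine (H.comparable_of_eq hc hkc (view_subset _ _ hmB) hkm).elim id fun hmk =>
    maximal ⟨hk, ?_⟩ hmk
  obtain ⟨-, y, hy, hyB', hmy⟩ := mem_view.1 hmB'
  rcases hmy.eq_or_lt with rfl | hmy
  · exact mem_view_of_mem hkc (hkm ▸ hyB')
  -- The label of an immediate successor `z` of `m` is dependent on that of `k`, so `z` and `k` are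
  -- comparable; if `z` lies below `y`, the smaller of the two belongs to both views.
  obtain ⟨z, hmz, hzy⟩ := exists_covBy_le_of_lt hmy
  have hzc := hc.mem_of_le hy hzy
  have hzB' : z ∈ view lab B' c := mem_view.2 ⟨hzc, y, hy, hyB', hzy⟩
  have dependent : ¬ A.indep (lab k) (lab z) := hkm ▸ H.les2 m z (.inl hmz)
  rcases H.comparable hc hkc hzc dependent with hkz | hzk
  · exact (hc.view B').mem_of_le hzB' hkz
  · exact absurd (maximal ⟨(hc.view B).mem_of_le hk hzk, hzB'⟩ hmz.le) hmz.lt.not_ge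

theorem exists_common_last (hc : S.IsConfiguration c) (hB : f ∈ view lab B c)
    (hB' : f ∈ view lab B' c) :
    ∃ g m, last lab g (view lab B c) = some m ∧ last lab g (view lab B' c) = some m ∧ f ≤ m := by
  obtain ⟨m, hfm, hm⟩ := (view lab B c ∩ view lab B' c).exists_le_maximal
    (Finset.mem_inter.2 ⟨hB, hB'⟩)
  simp only [Finset.mem_inter] at hm
  have hm' : Maximal (fun k => k ∈ view lab B' c ∧ k ∈ view lab B c) m := by
    simpa only [and_comm] using hm
  exact ⟨lab m, m, H.last_view_of_maximal hc hm, H.last_view_of_maximal hc hm', hfm⟩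

end IsTraceLabeling

end EventStructure

/-! ### Time stamps -/

namespace EventStructure

open scoped Classical

variable {E : Type u} [PartialOrder E] {S : EventStructure E} {c : Finset E} {e f : E}
  {L : Type} {lab : E → L} {B B' : Set L} {g : L} {A : IndependenceAlphabet L}

/-- A time stamp that is not among the given ones. There are more stamps `Option L` than letters, so
one is left if `L` is finite. -/
noncomputable def freshStamp (F : L → Option (Option L)) : Option L :=
  Classical.epsilon fun k => ∀ h, F h ≠ some k

theorem freshStamp_spec [Finite L] (F : L → Option (Option L)) (h : L) :
    F h ≠ some (freshStamp F) := by
  suffices ∃ k, ∀ h, F h ≠ some k from Classical.epsilon_spec this h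
  by_contra! hF
  choose g hg using hF
  have injective : Function.Injective g := fun k k' h =>
    Option.some.inj ((hg k).symm.trans (h ▸ hg k'))
  have := Nat.card_le_card_of_injective g injective
  rw [Finite.card_option] at this
  omega

variable (S lab) in
/-- Time stamps, chosen recursively such that the stamp of `e` differs from the stamps of the last
events with the same label in the views on the past of `e`. They make it possible to compare last
events by finitely many values. -/
noncomputable def stamp : E → Option L :=
  S.wellFoundedLT.wf.fix fun e ih => freshStamp fun h =>
    (last lab (lab e) (view lab {h} (S.past e))).map fun f =>
      if hf : f < e then ih f hf else none

theorem stamp_eq (e : E) : S.stamp lab e = freshStamp fun h =>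
    (last lab (lab e) (view lab {h} (S.past e))).map (S.stamp lab) := by
  rw [stamp, WellFounded.fix_eq]
  congr 1
  funext h
  refine Option.map_congr fun f hf => dif_pos ?_
  exact mem_past.1 (view_subset _ _ (last_eq_some.1 hf).1.1)

namespace IsTraceLabeling

variable (H : S.IsTraceLabeling lab A.indep)
include H

theorem exists_last_view_past (hc : S.IsConfiguration c) (he : e ∈ c)
    (hf : last lab (lab e) (view lab B c) = some f) (hfe : f < e) :
    ∃ h, last lab (lab e) (view lab {h} (S.past e)) = some f := by
  obtain ⟨⟨hfB, hf_lab⟩, greatest⟩ := last_eq_some.1 hf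
  have heB : e ∉ view lab B c := fun h => (greatest ⟨h, rfl⟩).not_gt hfe
  have hsub : S.causes e ∪ view lab B c ⊆ c := Finset.union_subset
    (fun g hg => hc.mem_of_le he (mem_causes.1 hg)) (view_subset _ _)
  have hconf : S.IsConfiguration (S.causes e ∪ view lab B c) := by
    refine hc.of_subset hsub fun g hg k hk => ?_
    rw [Finset.mem_union] at hg ⊢
    exact hg.imp ((isConfiguration_causes e).mem_of_le · hk) ((hc.view B).mem_of_le · hk)
  have view_B : view lab B (S.causes e ∪ view lab B c) = view lab B c :=
    view_eq_of_subset hsub Finset.subset_union_right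
  have view_e : view lab {lab e} (S.causes e ∪ view lab B c) = S.causes e := by
    refine view_singleton_eq_causes hconf (last_eq_some.2 ⟨⟨?_, rfl⟩, fun k ⟨hk, hke⟩ => ?_⟩)
    · exact Finset.mem_union_left _ (mem_causes.2 le_rfl)
    · rcases Finset.mem_union.1 hk with hk | hk
      · exact mem_causes.1 hk
      · exact (greatest ⟨hk, hke⟩).trans hfe.le
  obtain ⟨h, m, last_e, last_B, hfm⟩ := H.exists_common_last hconf (B := {lab e}) (B' := B)
    (view_e.symm ▸ mem_causes.2 hfe.le) (view_B.symm ▸ hfB)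
  rw [view_e, last_eq_some] at last_e
  rw [view_B, last_eq_some] at last_B
  obtain ⟨⟨hme, hmh⟩, greatest_h⟩ := last_e
  have hme : m < e := (mem_causes.1 hme).lt_of_ne fun h => heB (h ▸ last_B.1.1)
  refine ⟨h, last_eq_some.2 ⟨⟨?_, hf_lab⟩, fun k ⟨hk, hke⟩ => ?_⟩⟩
  · exact mem_view.2 ⟨mem_past.2 hfe, m, mem_past.2 hme, hmh, hfm⟩
  · obtain ⟨-, y, hy, hyh, hky⟩ := mem_view.1 hk
    have hym : y ≤ m := greatest_h ⟨mem_causes.2 (mem_past.1 hy).le, hyh⟩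
    exact greatest ⟨(hc.view B).mem_of_le last_B.1.1 (hky.trans hym), hke⟩

theorem stamp_ne_of_lt [Finite L] (hc : S.IsConfiguration c) (he : e ∈ c)
    (hf : last lab (lab e) (view lab B c) = some f) (hfe : f < e) :
    S.stamp lab f ≠ S.stamp lab e := by
  obtain ⟨h, last_f⟩ := H.exists_last_view_past hc he hf hfe
  rw [stamp_eq e]
  intro heq
  refine freshStamp_spec (fun h => (last lab (lab e) (view lab {h} (S.past e))).map (S.stamp lab))
    h ?_
  simp only [last_f, Option.map_some, heq]

theorem map_stamp_eq_iff [Finite L] (hc : S.IsConfiguration c) :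
    (last lab g (view lab B c)).map (S.stamp lab) = (last lab g (view lab B' c)).map (S.stamp lab) ↔
      last lab g (view lab B c) = last lab g (view lab B' c) := by
  refine ⟨fun h => ?_, fun h => by rw [h]⟩
  rcases hB : last lab g (view lab B c) with _ | e <;>
    rcases hB' : last lab g (view lab B' c) with _ | f
  · rfl
  · simp [hB, hB'] at h
  · simp [hB, hB'] at h
  · simp only [hB, hB', Option.map_some, Option.some.injEq] at h
    obtain ⟨⟨he, rfl⟩, -⟩ := last_eq_some.1 hB
    obtain ⟨⟨hf, hfe⟩, -⟩ := last_eq_some.1 hB'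
    have he := view_subset _ _ he
    have hf := view_subset _ _ hf
    rw [Option.some.injEq]
    by_contra hne
    rcases H.comparable_of_eq hc he hf hfe.symm with hle | hle
    · exact H.stamp_ne_of_lt hc hf (hfe ▸ hB) (hle.lt_of_ne hne) h
    · exact H.stamp_ne_of_lt hc he hB' (hle.lt_of_ne (Ne.symm hne)) h.symm

end IsTraceLabeling

/-! ### Effects of sets of events -/

variable {M : Type*} {effect : E → M → M} {s t : Finset E} {l l' : List E}

/-- A linear extension of the causal order. -/
def totalOrder : E → E → Prop := (extend_partialOrder (α := E) (· ≤ ·)).choose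

instance : IsLinearOrder E totalOrder := (extend_partialOrder (α := E) (· ≤ ·)).choose_spec.1

theorem totalOrder_of_le (h : e ≤ f) : totalOrder e f :=
  (extend_partialOrder (α := E) (· ≤ ·)).choose_spec.2 e f h

/-- An enumeration of `s` in which every event comes after the events below it. -/
noncomputable def linearization (s : Finset E) : List E := s.sort totalOrder

theorem mem_linearization : e ∈ linearization s ↔ e ∈ s := Finset.mem_sort _

theorem nodup_linearization (s : Finset E) : (linearization s).Nodup := Finset.sort_nodup _ _

theorem pairwise_linearization (s : Finset E) :
    (linearization s).Pairwise fun e f => ¬ f ≤ e :=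
  ((Finset.pairwise_sort s totalOrder).and (nodup_linearization s)).imp fun h hle =>
    h.2 (antisymm h.1 (totalOrder_of_le hle))

/-- The composition of the effects of the events in `s`, in the order of a linearization. -/
noncomputable def foldEvents (effect : E → M → M) (s : Finset E) (m : M) : M :=
  (linearization s).foldl (fun m e => effect e m) m

theorem foldEvents_empty (m : M) : foldEvents effect ∅ m = m := by
  rw [foldEvents, linearization, Finset.sort_empty, List.foldl_nil]

theorem foldEvents_singleton (e : E) (m : M) : foldEvents effect {e} m = effect e m := by
  rw [foldEvents, linearization, Finset.sort_singleton, List.foldl_cons, List.foldl_nil]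

omit [PartialOrder E] in
theorem foldl_comm_of_commute (h : ∀ g ∈ l, Function.Commute (effect e) (effect g)) (m : M) :
    effect e (l.foldl (fun m e => effect e m) m) =
      l.foldl (fun m e => effect e m) (effect e m) := by
  induction l generalizing m with
  | nil => rfl
  | cons g l ih =>
    rw [List.forall_mem_cons] at h
    rw [List.foldl_cons, ih h.2, List.foldl_cons, h.1.eq]

theorem IsTraceLabeling.foldl_eq_of_perm (H : S.IsTraceLabeling lab A.indep)
    (commute : ∀ {e f}, A.indep (lab e) (lab f) → Function.Commute (effect e) (effect f))
    (conflict_free : ∀ e ∈ l, ∀ f ∈ l, ¬ S.conflict e f) (hl : l.Pairwise fun e f => ¬ f ≤ e)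
    (hl' : l'.Pairwise fun e f => ¬ f ≤ e) (perm : l.Perm l') (m : M) :
    l.foldl (fun m e => effect e m) m = l'.foldl (fun m e => effect e m) m := by
  induction l generalizing l' m with
  | nil => rw [List.nil_perm.1 perm]
  | cons e l ih =>
    obtain ⟨p, q, rfl⟩ := List.append_of_mem (perm.subset List.mem_cons_self)
    rw [List.pairwise_cons] at hl
    have perm' : l.Perm (p ++ q) := (perm.trans List.perm_middle).cons_inv
    have indep : ∀ g ∈ p, A.indep (lab e) (lab g) := by
      intro g hg
      have hgl : g ∈ l := perm'.symm.subset (List.mem_append_left _ hg)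
      by_contra hI
      rcases H.les3 e g hI with h | h | h
      · exact (List.pairwise_append.1 hl').2.2 g hg e List.mem_cons_self h
      · exact hl.1 g hgl h
      · exact conflict_free e List.mem_cons_self g (List.mem_cons_of_mem _ hgl) h
    rw [List.foldl_cons, List.foldl_append, List.foldl_cons,
      foldl_comm_of_commute fun g hg => commute (indep g hg), ← List.foldl_append]
    refine ih (fun a ha b hb => ?_) hl.2 (hl'.sublist (by simp)) perm' _
    exact conflict_free a (List.mem_cons_of_mem _ ha) b (List.mem_cons_of_mem _ hb)

theorem IsTraceLabeling.foldEvents_union (H : S.IsTraceLabeling lab A.indep)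
    (commute : ∀ {e f}, A.indep (lab e) (lab f) → Function.Commute (effect e) (effect f))
    (conflict_free : ∀ e ∈ s ∪ t, ∀ f ∈ s ∪ t, ¬ S.conflict e f)
    (hst : ∀ e ∈ s, ∀ f ∈ t, ¬ f ≤ e) (m : M) :
    foldEvents effect (s ∪ t) m = foldEvents effect t (foldEvents effect s m) := by
  have pairwise : (linearization s ++ linearization t).Pairwise fun e f => ¬ f ≤ e :=
    List.pairwise_append.2 ⟨pairwise_linearization s, pairwise_linearization t, fun e he f hf =>
      hst e (mem_linearization.1 he) f (mem_linearization.1 hf)⟩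
  have perm : (linearization (s ∪ t)).Perm (linearization s ++ linearization t) := by
    refine (List.perm_ext_iff_of_nodup (nodup_linearization _) ?_).2 fun e => ?_
    · exact pairwise.imp fun h heq => h heq.ge
    · simp only [List.mem_append, mem_linearization, Finset.mem_union]
  simp only [foldEvents]
  rw [← List.foldl_append]
  refine H.foldl_eq_of_perm commute ?_ (pairwise_linearization _) pairwise perm m
  simpa only [mem_linearization] using conflict_free

theorem IsTraceLabeling.foldEvents_insert (H : S.IsTraceLabeling lab A.indep)
    (commute : ∀ {e f}, A.indep (lab e) (lab f) → Function.Commute (effect e) (effect f))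
    (conflict_free : ∀ f ∈ insert e s, ∀ g ∈ insert e s, ¬ S.conflict f g)
    (he : ∀ f ∈ s, ¬ e ≤ f) (m : M) :
    foldEvents effect (insert e s) m = effect e (foldEvents effect s m) := by
  rw [Finset.insert_eq, Finset.union_comm] at conflict_free ⊢
  rw [H.foldEvents_union commute conflict_free (by simpa using he), foldEvents_singleton]

end EventStructure

/-! ### Finite information about configurations -/

namespace EventStructure

open scoped Classical

variable {E : Type u} [PartialOrder E] {S : EventStructure E} {c x y : Finset E} {e f : E}
  {L M : Type} {lab : E → L} {G B B' : Set L} {g h : L} {A : IndependenceAlphabet L}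
  {act : L → M → M}

/-- Information about a configuration: the time stamps of the last events in the views of single
letters (`stamps g h` is that of the last event with label `g` in the view of `h`), the causal order
of the last events, and the effects of the complements of the views on `M`. -/
@[ext]
structure Info (L M : Type) where
  stamps : L → L → Option (Option L)
  lastLE : L → L → Prop
  effect : Set L → M → M

instance [Finite L] [Finite M] : Finite (Info L M) :=
  Finite.of_injective (fun i => (i.stamps, i.lastLE, i.effect)) fun i j h => by
    simp only [Prod.mk.injEq] at h
    exact Info.ext h.1 h.2.1 h.2.2

variable (S lab act) in
/-- The information about a configuration. -/
noncomputable def info (c : Finset E) : Info L M where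
  stamps g h := (last lab g (view lab {h} c)).map (S.stamp lab)
  lastLE g h := ∃ m n, last lab g c = some m ∧ last lab h c = some n ∧ m ≤ n
  effect G := foldEvents (fun e => act (lab e)) (c \ view lab G c)

theorem info_stamps_self (c : Finset E) (g : L) :
    (S.info lab act c).stamps g g = (last lab g c).map (S.stamp lab) := by
  simp only [info, last_view_of_mem (Set.mem_singleton g)]

namespace Info

variable (i j : Info L M)

/-- The letters whose last events in two views agree. -/
def common : Set L := {g | i.stamps g g = j.stamps g g}

/-- The letters whose last events in the second view belong to the first one. -/
def covered : Set L := {g | j.stamps g g = none ∨ ∃ h ∈ i.common j, j.lastLE g h}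

/-- Letters whose view on the first configuration is its intersection with the view of `G` on the
union. -/
def trunc (G : Set L) : Set L :=
  {h | (h ∈ G ∧ h ∈ i.covered j) ∨ ∃ g ∈ G, g ∉ i.covered j ∧ i.stamps h h = j.stamps h g}

/-- Letters whose view on the second configuration is its intersection with the union of the first
configuration and the view of `G` on the union. -/
def cotrunc (G : Set L) : Set L := i.common j ∪ {g | g ∈ G ∧ g ∉ i.covered j}

/-- The information about a union of two views, computed from that about the views. -/
noncomputable def merge : Info L M where
  stamps g h := if h ∈ i.covered j then i.stamps g h else j.stamps g h
  lastLE g h :=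
    if g ∈ i.covered j then if h ∈ i.covered j then i.lastLE g h else g ∈ i.common j ∧ j.lastLE g h
    else h ∉ i.covered j ∧ j.lastLE g h
  effect G := j.effect (i.cotrunc j G) ∘ i.effect (i.trunc j G)

/-- The information about the causes of an event with label `a`, computed from that about its
past. -/
noncomputable def extend (act : L → M → M) (a : L) (i : Info L M) : Info L M where
  stamps g h :=
    if h = a then if g = a then some (freshStamp (i.stamps a)) else i.stamps g g
    else i.stamps g h
  lastLE g h := if h = a then g = a ∨ i.stamps g g ≠ none else g ≠ a ∧ i.lastLE g h
  effect G := if a ∈ G then id else act a ∘ i.effect G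

end Info

variable (S lab) in
/-- The configuration `c` is the union of its views `x` and `y`. -/
structure IsUnionOfViews (x y c : Finset E) : Prop where
  isConfiguration : S.IsConfiguration c
  union_eq : x ∪ y = c
  exists_left : ∃ B, view lab B c = x
  exists_right : ∃ B, view lab B c = y

namespace IsUnionOfViews

variable (V : S.IsUnionOfViews lab x y c)
include V

theorem left : S.IsConfiguration x := by
  obtain ⟨B, rfl⟩ := V.exists_left
  exact V.isConfiguration.view B

theorem right : S.IsConfiguration y := by
  obtain ⟨B, rfl⟩ := V.exists_right
  exact V.isConfiguration.view B

theorem left_subset : x ⊆ c := V.union_eq ▸ Finset.subset_union_left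

theorem right_subset : y ⊆ c := V.union_eq ▸ Finset.subset_union_right

theorem mem_or_mem (h : e ∈ c) : e ∈ x ∨ e ∈ y := Finset.mem_union.1 (V.union_eq.symm ▸ h)

end IsUnionOfViews

variable (lab) in
/-- The last event of `y` with label `g`, if there is one, belongs to `x`. -/
def Covers (x y : Finset E) (g : L) : Prop := ∀ m, last lab g y = some m → m ∈ x

namespace IsTraceLabeling

section Merge

variable (H : S.IsTraceLabeling lab A.indep) (V : S.IsUnionOfViews lab x y c)
include H V

theorem exists_common_last_of_mem (hx : f ∈ x) (hy : f ∈ y) :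
    ∃ g m, last lab g x = some m ∧ last lab g y = some m ∧ f ≤ m := by
  obtain ⟨B, rfl⟩ := V.exists_left
  obtain ⟨B', rfl⟩ := V.exists_right
  exact H.exists_common_last V.isConfiguration hx hy

theorem mem_common [Finite L] :
    g ∈ (S.info lab act x).common (S.info lab act y) ↔ last lab g x = last lab g y := by
  obtain ⟨B, rfl⟩ := V.exists_left
  obtain ⟨B', rfl⟩ := V.exists_right
  rw [Info.common, Set.mem_ofPred_eq, info_stamps_self, info_stamps_self]
  exact H.map_stamp_eq_iff V.isConfiguration

theorem mem_covered [Finite L] :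
    g ∈ (S.info lab act x).covered (S.info lab act y) ↔ Covers lab x y g := by
  rw [Info.covered, Set.mem_ofPred_eq, info_stamps_self, Option.map_eq_none_iff]
  constructor
  · rintro (hnone | ⟨h, hh, m, n, hm, hn, hmn⟩) k hk
    · simp [hnone] at hk
    · obtain rfl : m = k := Option.some.inj (hm.symm.trans hk)
      rw [H.mem_common V, hn, last_eq_some] at hh
      exact V.left.mem_of_le hh.1.1 hmn
  · intro covers
    rcases hl : last lab g y with _ | m
    · exact .inl rfl
    · obtain ⟨k, n, hx, hy, hmn⟩ :=
        H.exists_common_last_of_mem V (covers m hl) (last_eq_some.1 hl).1.1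
      exact .inr ⟨k, (H.mem_common V).2 (hx.trans hy.symm), m, n, hl, hy, hmn⟩

theorem last_of_covers (hg : Covers lab x y g) : last lab g c = last lab g x := by
  ext m
  rw [last_eq_some, last_eq_some]
  constructor
  · rintro ⟨⟨hm, hmg⟩, greatest⟩
    refine ⟨⟨?_, hmg⟩, fun f hf => greatest ⟨V.left_subset hf.1, hf.2⟩⟩
    refine (V.mem_or_mem hm).elim id fun hmy => hg m (last_eq_some.2 ⟨⟨hmy, hmg⟩, fun f hf => ?_⟩)
    exact greatest ⟨V.right_subset hf.1, hf.2⟩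
  · rintro ⟨⟨hm, hmg⟩, greatest⟩
    refine ⟨⟨V.left_subset hm, hmg⟩, fun f ⟨hf, hfg⟩ => ?_⟩
    rcases V.mem_or_mem hf with hfx | hfy
    · exact greatest ⟨hfx, hfg⟩
    · obtain ⟨k, hk, hfk⟩ := H.exists_last V.right hfy
      rw [hfg] at hk
      exact hfk.trans (greatest ⟨hg k hk, (last_eq_some.1 hk).1.2⟩)

theorem last_of_not_covers (hg : ¬ Covers lab x y g) :
    ∃ m, last lab g c = some m ∧ last lab g y = some m ∧ m ∉ x := by
  simp only [Covers, not_forall] at hg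
  obtain ⟨m, hm, hmx⟩ := hg
  refine ⟨m, ?_, hm, hmx⟩
  obtain ⟨⟨hmy, hmg⟩, greatest⟩ := last_eq_some.1 hm
  refine last_eq_some.2 ⟨⟨V.right_subset hmy, hmg⟩, fun f ⟨hf, hfg⟩ => ?_⟩
  rcases V.mem_or_mem hf with hfx | hfy
  · exact (H.comparable_of_eq V.isConfiguration hf (V.right_subset hmy)
      (hfg.trans hmg.symm)).resolve_right fun hmf => hmx (V.left.mem_of_le hfx hmf)
  · exact greatest ⟨hfy, hfg⟩

theorem view_of_covers (hg : Covers lab x y g) : view lab {g} c = view lab {g} x := by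
  ext e
  rw [H.mem_view_iff V.isConfiguration, H.mem_view_iff V.left]
  simp [H.last_of_covers V hg]

theorem view_of_not_covers (hg : ¬ Covers lab x y g) : view lab {g} c = view lab {g} y := by
  obtain ⟨m, hc, hy, -⟩ := H.last_of_not_covers V hg
  rw [view_singleton_eq_causes V.isConfiguration hc, view_singleton_eq_causes V.right hy]

theorem lastLE_of_covers_of_not_covers (hg : Covers lab x y g) (hh : ¬ Covers lab x y h) :
    (S.info lab act c).lastLE g h ↔
      last lab g x = last lab g y ∧ (S.info lab act y).lastLE g h := by
  obtain ⟨n, hc, hy, -⟩ := H.last_of_not_covers V hh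
  simp only [info, H.last_of_covers V hg, hc, hy, Option.some.injEq]
  constructor
  · rintro ⟨m, _, hm, rfl, hmn⟩
    have hmc : last lab g c = some m := (H.last_of_covers V hg).trans hm
    obtain ⟨⟨-, hmg⟩, greatest⟩ := last_eq_some.1 hmc
    have hmy : last lab g y = some m := last_eq_some.2
      ⟨⟨V.right.mem_of_le (last_eq_some.1 hy).1.1 hmn, hmg⟩, fun f hf =>
        greatest ⟨V.right_subset hf.1, hf.2⟩⟩
    exact ⟨hm.trans hmy.symm, m, n, hmy, rfl, hmn⟩
  · rintro ⟨agree, m, _, hm, rfl, hmn⟩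
    exact ⟨m, n, agree.trans hm, rfl, hmn⟩

variable [Finite L]

theorem info_stamps_eq_merge :
    (S.info lab act c).stamps = ((S.info lab act x).merge (S.info lab act y)).stamps := by
  funext g h
  simp only [Info.merge, H.mem_covered V]
  split_ifs with hh
  · simp only [info, H.view_of_covers V hh]
  · simp only [info, H.view_of_not_covers V hh]

theorem info_lastLE_eq_merge :
    (S.info lab act c).lastLE = ((S.info lab act x).merge (S.info lab act y)).lastLE := by
  funext g h
  apply propext
  simp only [Info.merge, H.mem_covered V, H.mem_common V]
  split_ifs with hg hh
  · simp only [info, H.last_of_covers V hg, H.last_of_covers V hh]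
  · exact H.lastLE_of_covers_of_not_covers V hg hh
  · obtain ⟨m, hmc, hmy, hmx⟩ := H.last_of_not_covers V hg
    by_cases hh : Covers lab x y h
    · refine iff_of_false ?_ fun h' => h'.1 hh
      rintro ⟨_, n, hm, hn, hmn⟩
      obtain rfl := Option.some.inj (hmc.symm.trans hm)
      rw [H.last_of_covers V hh, last_eq_some] at hn
      exact hmx (V.left.mem_of_le hn.1.1 hmn)
    · obtain ⟨n, hnc, hny, -⟩ := H.last_of_not_covers V hh
      simp [info, hmc, hmy, hnc, hny, hh]

theorem mem_view_trunc (hx : e ∈ x) :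
    e ∈ view lab ((S.info lab act x).trunc (S.info lab act y) G) x ↔ e ∈ view lab G c := by
  rw [H.mem_view_iff V.left, H.mem_view_iff V.isConfiguration]
  simp only [Info.trunc, Set.mem_ofPred_eq, H.mem_covered V, info_stamps_self]
  simp only [info]
  constructor
  · rintro ⟨h, ⟨hhG, hh⟩ | ⟨g, hgG, hg, agree⟩, n, hn, hen⟩
    · exact ⟨h, hhG, n, (H.last_of_covers V hh).trans hn, hen⟩
    · obtain ⟨k, hk, -⟩ := H.last_of_not_covers V hg
      refine ⟨g, hgG, k, hk, hen.trans ?_⟩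
      obtain ⟨B, rfl⟩ := V.exists_left
      rw [← H.view_of_not_covers V hg, H.map_stamp_eq_iff V.isConfiguration, hn] at agree
      obtain ⟨⟨hnv, -⟩, -⟩ := last_eq_some.1 agree.symm
      rwa [view_singleton_eq_causes V.isConfiguration hk, mem_causes] at hnv
  · rintro ⟨g, hgG, k, hk, hek⟩
    by_cases hg : Covers lab x y g
    · exact ⟨g, .inl ⟨hgG, hg⟩, k, (H.last_of_covers V hg).symm.trans hk, hek⟩
    · have hev : e ∈ view lab {g} c :=
        view_singleton_eq_causes V.isConfiguration hk ▸ mem_causes.2 hek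
      obtain ⟨B, rfl⟩ := V.exists_left
      obtain ⟨h, n, hnx, hng, hen⟩ := H.exists_common_last V.isConfiguration hx hev
      refine ⟨h, .inr ⟨g, hgG, hg, ?_⟩, n, hnx, hen⟩
      rw [← H.view_of_not_covers V hg, hnx, hng]

theorem mem_view_cotrunc (hy : e ∈ y) :
    e ∈ view lab ((S.info lab act x).cotrunc (S.info lab act y) G) y ↔
      e ∈ x ∨ e ∈ view lab G c := by
  rw [H.mem_view_iff V.right, H.mem_view_iff V.isConfiguration]
  simp only [Info.cotrunc, Set.mem_union, Set.mem_ofPred_eq, H.mem_common V, H.mem_covered V]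
  have of_mem (hx : e ∈ x) : ∃ g, (last lab g x = last lab g y ∨ g ∈ G ∧ ¬ Covers lab x y g) ∧
      ∃ m, last lab g y = some m ∧ e ≤ m := by
    obtain ⟨k, n, hnx, hny, hen⟩ := H.exists_common_last_of_mem V hx hy
    exact ⟨k, .inl (hnx.trans hny.symm), n, hny, hen⟩
  constructor
  · rintro ⟨g, agree | ⟨hgG, hg⟩, n, hn, hen⟩
    · exact .inl (V.left.mem_of_le (last_eq_some.1 (agree.trans hn)).1.1 hen)
    · obtain ⟨k, hkc, hky, -⟩ := H.last_of_not_covers V hg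
      exact .inr ⟨g, hgG, n, hkc.trans (hky.symm.trans hn), hen⟩
  · rintro (hx | ⟨g, hgG, k, hk, hek⟩)
    · exact of_mem hx
    · by_cases hg : Covers lab x y g
      · rw [H.last_of_covers V hg, last_eq_some] at hk
        exact of_mem (V.left.mem_of_le hk.1.1 hek)
      · obtain ⟨k', hkc, hky, -⟩ := H.last_of_not_covers V hg
        exact ⟨g, .inr ⟨hgG, hg⟩, k, hky.trans (hkc.symm.trans hk), hek⟩

theorem sdiff_view_eq_union (act : L → M → M) (G : Set L) :
    c \ view lab G c = x \ view lab ((S.info lab act x).trunc (S.info lab act y) G) x ∪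
      y \ view lab ((S.info lab act x).cotrunc (S.info lab act y) G) y := by
  ext e
  have trunc (hx : e ∈ x) := H.mem_view_trunc (act := act) (G := G) V hx
  have cotrunc (hy : e ∈ y) := H.mem_view_cotrunc (act := act) (G := G) V hy
  have := V.mem_or_mem (e := e)
  have left (h : e ∈ x) : e ∈ c := V.left_subset h
  have right (h : e ∈ y) : e ∈ c := V.right_subset h
  simp only [Finset.mem_sdiff, Finset.mem_union]
  tauto

theorem info_effect_eq_merge
    (commute : ∀ {a b}, A.indep a b → Function.Commute (act a) (act b)) :
    (S.info lab act c).effect = ((S.info lab act x).merge (S.info lab act y)).effect := by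
  funext G m
  have split := H.sdiff_view_eq_union V act G
  change foldEvents (fun e => act (lab e)) (c \ view lab G c) m = _
  rw [split]
  refine H.foldEvents_union commute (fun e he f hf => ?_) (fun e he f hf hfe => ?_) m
  · rw [← split, Finset.mem_sdiff] at he hf
    exact V.isConfiguration.not_conflict he.1 hf.1
  · rw [Finset.mem_sdiff] at he hf
    exact hf.2 ((H.mem_view_cotrunc V hf.1).2 (.inl (V.left.mem_of_le he.1 hfe)))

end Merge

variable (H : S.IsTraceLabeling lab A.indep)
  (commute : ∀ {a b}, A.indep a b → Function.Commute (act a) (act b))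
include H commute

theorem info_view_union [Finite L] (hc : S.IsConfiguration c) (B B' : Set L) :
    S.info lab act (view lab (B ∪ B') c) =
      (S.info lab act (view lab B c)).merge (S.info lab act (view lab B' c)) := by
  have V : S.IsUnionOfViews lab (view lab B c) (view lab B' c) (view lab (B ∪ B') c) :=
    ⟨hc.view _, (view_union B B' c).symm, ⟨B, view_view Set.subset_union_left⟩,
      ⟨B', view_view Set.subset_union_right⟩⟩
  exact Info.ext (H.info_stamps_eq_merge V) (H.info_lastLE_eq_merge V)
    (H.info_effect_eq_merge V commute)

end IsTraceLabeling

end EventStructure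

/-! ### Adding an event -/

namespace EventStructure

open scoped Classical

variable {E : Type u} [PartialOrder E] {S : EventStructure E} {c : Finset E} {e f : E}
  {L M : Type} {lab : E → L} {G : Set L} {g : L} {A : IndependenceAlphabet L} {act : L → M → M}

theorem last_causes_self (e : E) : last lab (lab e) (S.causes e) = some e :=
  last_eq_some.2 ⟨⟨mem_causes.2 le_rfl, rfl⟩, fun _ hf => mem_causes.1 hf.1⟩

theorem last_causes_of_ne (hg : g ≠ lab e) :
    last lab g (S.causes e) = last lab g (S.past e) := by
  have same : {f | f ∈ S.causes e ∧ lab f = g} = {f | f ∈ S.past e ∧ lab f = g} := by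
    ext f
    simp only [Set.mem_ofPred_eq, mem_causes, mem_past, le_iff_lt_or_eq]
    grind
  ext m
  rw [last_eq_some, last_eq_some, same]

theorem view_causes_of_mem (he : lab e ∈ G) : view lab G (S.causes e) = S.causes e :=
  (view_subset _ _).antisymm fun _ hf =>
    mem_view.2 ⟨hf, e, mem_causes.2 le_rfl, he, mem_causes.1 hf⟩

theorem view_causes_of_notMem (he : lab e ∉ G) :
    view lab G (S.causes e) = view lab G (S.past e) := by
  refine (view_eq_of_subset (Finset.erase_subset _ _) fun f hf => ?_).symm
  obtain ⟨-, k, hk, hkG, hfk⟩ := mem_view.1 hf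
  exact mem_past.2 (hfk.trans_lt ((mem_causes.1 hk).lt_of_ne (by rintro rfl; exact he hkG)))

theorem causes_sdiff_view (he : lab e ∉ G) :
    S.causes e \ view lab G (S.causes e) = insert e (S.past e \ view lab G (S.past e)) := by
  rw [view_causes_of_notMem he, ← insert_past, Finset.insert_sdiff_of_notMem]
  exact fun h => (enabled_past e).notMem (view_subset _ _ h)

theorem info_causes_stamps (e : E) :
    (S.info lab act (S.causes e)).stamps =
      ((S.info lab act (S.past e)).extend act (lab e)).stamps := by
  funext g h
  simp only [Info.extend, info_stamps_self]
  simp only [info]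
  split_ifs with hh hg
  · rw [hh, hg, view_causes_of_mem (Set.mem_singleton _), last_causes_self, Option.map_some,
      stamp_eq]
  · rw [hh, view_causes_of_mem (Set.mem_singleton _), last_causes_of_ne hg]
  · rw [view_causes_of_notMem fun he => hh (Set.mem_singleton_iff.1 he).symm]

theorem info_causes_lastLE (e : E) :
    (S.info lab act (S.causes e)).lastLE =
      ((S.info lab act (S.past e)).extend act (lab e)).lastLE := by
  funext g h
  apply propext
  simp only [Info.extend, info_stamps_self]
  simp only [info]
  split_ifs with hh
  · subst hh
    by_cases hg : g = lab e
    · simp [hg, last_causes_self]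
    · simp only [last_causes_self, last_causes_of_ne hg, hg, false_or, ne_eq,
        Option.map_eq_none_iff, ← Option.isSome_iff_ne_none, Option.isSome_iff_exists]
      constructor
      · rintro ⟨m, -, hm, -⟩
        exact ⟨m, hm⟩
      · rintro ⟨m, hm⟩
        exact ⟨m, e, hm, rfl, (mem_past.1 (last_eq_some.1 hm).1.1).le⟩
  · rw [last_causes_of_ne hh]
    by_cases hg : g = lab e
    · refine iff_of_false ?_ fun h => h.1 hg
      rintro ⟨m, n, hm, hn, hen⟩
      obtain rfl : e = m := Option.some.inj ((last_causes_self e).symm.trans (hg ▸ hm))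
      exact (mem_past.1 (last_eq_some.1 hn).1.1).not_ge hen
    · simp [last_causes_of_ne hg, hg]

namespace IsTraceLabeling

variable (H : S.IsTraceLabeling lab A.indep)
include H

theorem info_causes_effect
    (commute : ∀ {a b}, A.indep a b → Function.Commute (act a) (act b)) (e : E) :
    (S.info lab act (S.causes e)).effect =
      ((S.info lab act (S.past e)).extend act (lab e)).effect := by
  funext G m
  simp only [Info.extend]
  simp only [info]
  split_ifs with he
  · rw [view_causes_of_mem he, Finset.sdiff_self, foldEvents_empty, id]
  · rw [causes_sdiff_view he]
    refine H.foldEvents_insert commute (fun f hf g hg => ?_) (fun f hf => ?_) m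
    · rw [← causes_sdiff_view he, Finset.mem_sdiff] at hf hg
      exact (isConfiguration_causes e).not_conflict hf.1 hg.1
    · exact (mem_past.1 (Finset.mem_sdiff.1 hf).1).not_ge

theorem info_causes (commute : ∀ {a b}, A.indep a b → Function.Commute (act a) (act b)) (e : E) :
    S.info lab act (S.causes e) = (S.info lab act (S.past e)).extend act (lab e) :=
  Info.ext (info_causes_stamps e) (info_causes_lastLE e) (H.info_causes_effect commute e)

theorem enabled_unique (he : S.Enabled c e) (hf : S.Enabled c f) (h : lab e = lab f) : e = f := by
  by_contra hne
  rcases H.les3 e f (h ▸ A.irrefl _) with hef | hfe | conflict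
  · exact he.notMem (hf.mem_of_lt (hef.lt_of_ne hne))
  · exact hf.notMem (he.mem_of_lt (hfe.lt_of_ne' hne))
  · refine H.les1 e f ⟨conflict, ?_⟩ h
    rintro ⟨k, hke, hkf, ⟨hle, hk⟩ | ⟨hle, hk⟩⟩
    · exact hf.not_conflict k (he.mem_of_lt (hle.lt_of_ne hke)) hk
    · exact he.not_conflict k (hf.mem_of_lt (hle.lt_of_ne hkf)) hk

theorem enabled_swap (hc : S.IsConfiguration c) (he : S.Enabled c e) (hf : S.Enabled (insert e c) f)
    (hI : A.indep (lab e) (lab f)) : S.Enabled c f ∧ S.Enabled (insert f c) e := by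
  have not_lt : ¬ e < f := by
    intro hlt
    refine H.les2 e f (.inl ⟨hlt, fun k hek hkf => ?_⟩) hI
    rcases Finset.mem_insert.1 (hf.mem_of_lt hkf) with rfl | hk
    · exact lt_irrefl _ hek
    · exact he.notMem (hc.mem_of_le hk hek.le)
  have ne : f ≠ e := fun h => hf.notMem (Finset.mem_insert.2 (.inl h))
  constructor
  · exact
      { notMem := fun h => hf.notMem (Finset.mem_insert_of_mem h)
        not_conflict := fun k hk => hf.not_conflict k (Finset.mem_insert_of_mem hk)
        mem_of_lt := fun hk => (Finset.mem_insert.1 (hf.mem_of_lt hk)).resolve_left fun h =>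
          not_lt (h ▸ hk) }
  · refine ⟨?_, fun k hk hke => ?_, fun hk => Finset.mem_insert_of_mem (he.mem_of_lt hk)⟩
    · simp only [Finset.mem_insert, ne.symm, he.notMem, or_self, not_false_eq_true]
    · rcases Finset.mem_insert.1 hk with rfl | hk
      · exact hf.not_conflict e (Finset.mem_insert_self _ _) (S.conflict_symm _ _ hke)
      · exact he.not_conflict k hk hke

theorem view_eq_past (hc : S.IsConfiguration c) (he : S.Enabled c e) :
    view lab {g | ¬ A.indep (lab e) g} c = S.past e := by
  ext k
  rw [mem_past, mem_view]
  constructor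
  · rintro ⟨-, f, hf, dependent, hkf⟩
    rcases H.les3 e f dependent with hef | hfe | conflict
    · exact absurd (hc.mem_of_le hf hef) he.notMem
    · exact hkf.trans_lt (hfe.lt_of_ne (by rintro rfl; exact he.notMem hf))
    · exact absurd (S.conflict_symm _ _ conflict) (he.not_conflict f hf)
  · intro hk
    obtain ⟨m, hkm, hm⟩ := (S.past e).exists_le_maximal (mem_past.2 hk)
    have hme := mem_past.1 hm.prop
    refine ⟨he.mem_of_lt hk, m, he.mem_of_lt hme, fun indep => ?_, hkm⟩
    refine H.les2 m e (.inl ⟨hme, fun n hmn hne => ?_⟩) (A.symm indep)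
    exact hm.not_gt (mem_past.2 hne) hmn

theorem enabled_of_enabled_view (hc : S.IsConfiguration c)
    (he : S.Enabled (view lab {g | ¬ A.indep (lab e) g} c) e) : S.Enabled c e := by
  have := S.wellFoundedLT
  refine ⟨fun h => he.notMem (mem_view_of_mem h (A.irrefl _)), ?_,
    fun hf => view_subset _ _ (he.mem_of_lt hf)⟩
  by_contra! hcon
  obtain ⟨f, ⟨hf, hfe⟩, hmin⟩ := exists_minimal_of_wellFoundedLT (fun f => f ∈ c ∧ S.conflict f e)
    hcon
  refine he.not_conflict f (mem_view_of_mem hf fun indep => ?_) hfe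
  refine H.les2 f e (.inr ⟨hfe, ?_⟩) (A.symm indep)
  rintro ⟨k, hkf, hke, ⟨hle, hk⟩ | ⟨hle, hk⟩⟩
  · exact hkf (hle.antisymm (hmin ⟨hc.mem_of_le hf hle, hk⟩ hle))
  · exact hc.not_conflict (view_subset _ _ (he.mem_of_lt (hle.lt_of_ne hke))) hf hk

theorem view_singleton_past (hc : S.IsConfiguration c) (he : S.Enabled c e)
    (hg : ¬ A.indep (lab e) g) : view lab {g} (S.past e) = view lab {g} c := by
  rw [← H.view_eq_past hc he, view_view (Set.singleton_subset_iff.2 hg)]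

theorem view_insert_self (hc : S.IsConfiguration c) (he : S.Enabled c e) :
    view lab {lab e} (insert e c) = S.causes e := by
  have hc' := hc.insert he
  have hmem := Finset.mem_insert_self e c
  refine view_singleton_eq_causes hc' (last_eq_some.2 ⟨⟨hmem, rfl⟩, fun f ⟨hf, hfe⟩ => ?_⟩)
  refine (H.comparable_of_eq hc' hf hmem hfe).elim id fun hef => ?_
  rcases Finset.mem_insert.1 hf with rfl | hf
  · exact le_rfl
  · exact absurd (hc.mem_of_le hf hef) he.notMem

end IsTraceLabeling

theorem view_insert_of_ne (hc : S.IsConfiguration c) (hg : g ≠ lab e) :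
    view lab {g} (insert e c) = view lab {g} c := by
  refine (view_eq_of_subset (Finset.subset_insert _ _) fun k hk => ?_).symm
  obtain ⟨-, f, hf, rfl, hkf⟩ := mem_view.1 hk
  exact hc.mem_of_le (Finset.mem_of_mem_insert_of_ne hf (by rintro rfl; exact hg rfl)) hkf

/-- The configuration obtained by adding an enabled event. -/
noncomputable def Domain.add (c : S.Domain) (he : S.Enabled c.1 e) : S.Domain :=
  ⟨insert e c.1, c.2.insert he⟩

theorem enabled_iff_isMin {c : S.Domain} (k : S.Residual c) : S.Enabled c.1 k.1 ↔ IsMin k := by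
  constructor
  · intro hk k' hle
    by_contra hge
    exact k'.2.1 (hk.mem_of_lt (hle.lt_of_not_ge hge))
  · intro hk
    refine ⟨k.2.1, fun f hf h => k.2.2 ⟨f, hf, h⟩, fun {f} hf => ?_⟩
    by_contra hfc
    exact hk.not_lt (b := ⟨f, hfc, fun ⟨f', hf', h⟩ =>
      k.2.2 ⟨f', hf', S.conflict_inherit _ _ _ h hf.le⟩⟩) hf

/-- The residual of a configuration after a minimal event `k` of its residual. -/
noncomputable def residualAdd {c : S.Domain} (k : S.Residual c) (hk : S.Enabled c.1 k.1) :
    S.Residual (c.add hk) ≃o {k' : S.Residual c // k' ≠ k ∧ ¬ (S.rooted c).conflict k k'} where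
  toFun f := ⟨⟨f.1, fun h => f.2.1 (Finset.mem_insert_of_mem h),
      fun ⟨g, hg, h⟩ => f.2.2 ⟨g, Finset.mem_insert_of_mem hg, h⟩⟩,
    fun h => f.2.1 (Finset.mem_insert.2 (.inl (congrArg Subtype.val h))),
    fun h => f.2.2 ⟨k.1, Finset.mem_insert_self _ _, h⟩⟩
  invFun f := ⟨f.1.1,
    fun h => (Finset.mem_insert.1 h).elim (fun h => f.2.1 (Subtype.ext h)) f.1.2.1,
    fun ⟨g, hg, h⟩ => (Finset.mem_insert.1 hg).elim (by rintro rfl; exact f.2.2 h)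
      fun hg => f.1.2.2 ⟨g, hg, h⟩⟩
  map_rel_iff' := Iff.rfl

end EventStructure

/-! ### The action of the letters on the futures -/

namespace EventStructure

open scoped Classical

variable {E : Type u} [PartialOrder E] {S : EventStructure E} {e : E}
  {L Q : Type} {lab : E → L} {G : Set L} {A : IndependenceAlphabet L} {q : S.Domain → Q}

theorem exists_enabled_of_equiv {c c' : S.Domain} (h : S.labeledFutureSetoid lab c c')
    (he : S.Enabled c.1 e) : ∃ (e' : E) (he' : S.Enabled c'.1 e'), lab e' = lab e ∧
      S.labeledFutureSetoid lab (c.add he) (c'.add he') := by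
  obtain ⟨φ, conflict_iff, lab_eq⟩ := h
  let k : S.Residual c := ⟨e, he.notMem, fun ⟨f, hf, h⟩ => he.not_conflict f hf h⟩
  have hk : S.Enabled c'.1 (φ k).1 :=
    (enabled_iff_isMin _).2 (φ.isMin_apply.2 ((enabled_iff_isMin k).1 he))
  let restriction : {k' : S.Residual c // k' ≠ k ∧ ¬ (S.rooted c).conflict k k'} ≃o
      {k' : S.Residual c' // k' ≠ φ k ∧ ¬ (S.rooted c').conflict (φ k) k'} :=
    { toEquiv := φ.toEquiv.subtypeEquiv fun k' =>
        and_congr φ.injective.ne_iff.symm (not_congr (conflict_iff k k'))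
      map_rel_iff' := φ.le_iff_le }
  exact ⟨_, hk, lab_eq k, (residualAdd k he).trans (restriction.trans (residualAdd (φ k) hk).symm),
    fun f g => conflict_iff (residualAdd k he f) (residualAdd k he g),
    fun f => lab_eq (residualAdd k he f)⟩

variable (lab q) in
/-- The futures that are reached from a set of futures by an event with label `a`. -/
def stepFutures (a : L) (s : Set Q) : Set Q :=
  {p | ∃ (c : S.Domain) (e : E) (he : S.Enabled c.1 e), q c ∈ s ∧ lab e = a ∧ p = q (c.add he)}

namespace IsTraceLabeling

variable (H : S.IsTraceLabeling lab A.indep)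
  (hq : ∀ c c', q c = q c' ↔ S.labeledFutureSetoid lab c c')
include H hq

theorem stepFutures_comm {a b : L} (hI : A.indep a b) :
    Function.Commute (stepFutures lab q a) (stepFutures lab q b) := by
  intro s
  suffices subset : ∀ {a b}, A.indep a b →
      stepFutures lab q a (stepFutures lab q b s) ⊆ stepFutures lab q b (stepFutures lab q a s) from
    (subset hI).antisymm (subset (A.symm hI))
  rintro a b hI _ ⟨d, f, hf, ⟨c, e, he, hc, rfl, hd⟩, rfl, rfl⟩
  obtain ⟨f', hf', hl, hr⟩ := exists_enabled_of_equiv ((hq _ _).1 hd) hf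
  obtain ⟨hcf, hfe⟩ := H.enabled_swap c.2 he hf' (hl ▸ A.symm hI)
  refine ⟨c.add hcf, e, hfe, ⟨c, f', hcf, hc, hl, rfl⟩, rfl, ((hq _ _).2 hr).trans ?_⟩
  exact congrArg q (Subtype.ext (Finset.insert_comm _ _ _))

theorem stepFutures_singleton (c : S.Domain) (he : S.Enabled c.1 e) :
    stepFutures lab q (lab e) {q c} = {q (c.add he)} := by
  ext p
  rw [Set.mem_singleton_iff]
  constructor
  · rintro ⟨d, f, hf, hd, hl, rfl⟩
    obtain ⟨f', hf', hl', hr⟩ := exists_enabled_of_equiv ((hq _ _).1 hd) hf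
    obtain rfl := H.enabled_unique hf' he (hl'.trans hl)
    exact (hq _ _).2 hr
  · rintro rfl
    exact ⟨c, e, he, rfl, rfl, rfl⟩

theorem foldEvents_stepFutures (c : S.Domain) :
    foldEvents (fun e => stepFutures lab q (lab e)) c.1 {q ⟨∅, isConfiguration_empty⟩} = {q c} := by
  obtain ⟨c, hc⟩ := c
  induction hc using IsConfiguration.induction with
  | empty => exact foldEvents_empty _
  | insert c e hc he ih =>
    rw [H.foldEvents_insert (H.stepFutures_comm hq) (hc.insert he).1
      (fun f hf hef => he.notMem (hc.mem_of_le hf hef)), ih]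
    exact H.stepFutures_singleton hq ⟨c, hc⟩ he

theorem future_eq_of_info_eq {c c' : S.Domain}
    (h : S.info lab (stepFutures lab q) c.1 = S.info lab (stepFutures lab q) c'.1) :
    q c = q c' := by
  have effect := congrFun (congrFun (congrArg Info.effect h) ∅) {q ⟨∅, isConfiguration_empty⟩}
  simp only [info, view_empty, Finset.sdiff_empty] at effect
  rw [H.foldEvents_stepFutures hq, H.foldEvents_stepFutures hq] at effect
  exact Set.singleton_injective effect

theorem info_view_eq [Finite L] {c c' : Finset E} (hc : S.IsConfiguration c)
    (hc' : S.IsConfiguration c') (h : ∀ g ∈ G, S.info lab (stepFutures lab q) (view lab {g} c) =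
      S.info lab (stepFutures lab q) (view lab {g} c')) :
    S.info lab (stepFutures lab q) (view lab G c) =
      S.info lab (stepFutures lab q) (view lab G c') := by
  have commute {a b} (hI : A.indep a b) := H.stepFutures_comm hq hI
  induction G, G.toFinite using Set.Finite.induction_on with
  | empty => rw [view_empty, view_empty]
  | @insert g G _ _ ih =>
    rw [Set.insert_eq, H.info_view_union commute hc, H.info_view_union commute hc',
      h g (Set.mem_insert _ _), ih fun k hk => h k (Set.mem_insert_of_mem _ hk)]

theorem exists_enabled_of_info_eq [Finite L] {c : Finset E} (hc : S.IsConfiguration c)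
    (h : ∀ g, ¬ A.indep (lab e) g → S.info lab (stepFutures lab q) (view lab {g} c) =
      S.info lab (stepFutures lab q) (view lab {g} (S.past e))) :
    ∃ e', S.Enabled c e' ∧ lab e' = lab e ∧ S.info lab (stepFutures lab q) (S.causes e') =
      S.info lab (stepFutures lab q) (S.causes e) := by
  have hp := isConfiguration_past (S := S) e
  have info_eq := H.info_view_eq hq (G := {g | ¬ A.indep (lab e) g}) hc hp h
  rw [H.view_eq_past hp (enabled_past e)] at info_eq
  have future_eq := H.future_eq_of_info_eq hq (c := ⟨_, hc.view _⟩) (c' := ⟨_, hp⟩) info_eq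
  obtain ⟨e', he', hl, -⟩ := exists_enabled_of_equiv ((hq _ _).1 future_eq.symm) (enabled_past e)
  rw [← hl] at he' info_eq
  have he := H.enabled_of_enabled_view hc he'
  refine ⟨e', he, hl, ?_⟩
  rw [H.info_causes (H.stepFutures_comm hq), H.info_causes (H.stepFutures_comm hq), hl,
    ← info_eq, H.view_eq_past hc he]

end IsTraceLabeling

end EventStructure

/-! ### Principal filters of the unfolding -/

namespace ReversibleSystem

open CubeComplex

variable {T : Type} {A : IndependenceAlphabet T} {M : ReversibleSystem A} {v₀ : M.V}

theorem domainIsFilterOfUniversalCover {E : Type u} [PartialOrder E] {S : EventStructure E}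
    {ρ : S.Domain → M.unfolding.V}
    (posReach_iff : ∀ {c d}, M.unfolding.PosReach (ρ c) (ρ d) ↔ c ≤ d)
    (mem_range : ∀ {v}, M.unfolding.PosReach (M.root v₀) v ↔ v ∈ Set.range ρ) :
    S.DomainIsFilterOfUniversalCover (M.component v₀).complex := by
  let base : (M.cover v₀).V := ⟨M.root v₀, .refl⟩
  have reach_root {x : (M.cover v₀).complex.cube 0} :
      (M.cover v₀).orientation.Reach (vertexAt base) x ↔ (state x).1 ∈ Set.range ρ :=
    reach_orientation.trans (posReach_component.trans mem_range)
  let F (c : S.Domain) : (M.cover v₀).orientation.Filter (vertexAt base) :=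
    ⟨vertexAt ⟨ρ c, (mem_range.2 ⟨c, rfl⟩).connected⟩, reach_root.2 ⟨c, rfl⟩⟩
  have reach_iff {c d : S.Domain} : (M.cover v₀).orientation.Reach (F c).1 (F d).1 ↔ c ≤ d :=
    reach_orientation.trans (posReach_component.trans posReach_iff)
  have injective : Function.Injective F := fun c d h =>
    le_antisymm (reach_iff.1 (h ▸ .refl)) (reach_iff.1 (h ▸ .refl))
  have surjective : Function.Surjective F := fun ⟨x, hx⟩ => by
    obtain ⟨c, hc⟩ := reach_root.1 hx
    exact ⟨c, Subtype.ext (state_injective (Subtype.ext hc))⟩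
  refine ⟨(M.component v₀).orientation, _, M.coverHom v₀, vertexAt base,
    M.isUniversalCover_coverHom v₀, ?_⟩
  rw [lift_orientation]
  exact ⟨⟨Equiv.ofBijective F ⟨injective, surjective⟩, reach_iff⟩⟩

end ReversibleSystem

/-! ### Asynchronous cell systems -/

/-- A rule of an asynchronous system of cells indexed by `L`, in the sense of Zielonka: if the cells
dependent on `site` have the contents `pre`, the content of `site` may be replaced by `post`. -/
@[ext]
structure CellRule (L K : Type u) where
  site : L
  pre : L → K
  post : K

instance CellRule.finite {L K : Type u} [Finite L] [Finite K] : Finite (CellRule L K) :=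
  Finite.of_injective (fun t => (t.site, t.pre, t.post)) fun s t h => by
    simp only [Prod.mk.injEq] at h
    exact CellRule.ext h.1 h.2.1 h.2.2

/-- The alphabet of cell rules, which are independent if their sites are. -/
def IndependenceAlphabet.cellRules {L : Type u} (A : IndependenceAlphabet L) (K : Type u) :
    IndependenceAlphabet (CellRule L K) where
  indep t t' := A.indep t.site t'.site
  irrefl t := A.irrefl t.site
  symm h := A.symm h

open scoped Classical in
/-- The reversible system of the contents of cells, whose steps apply the rules in `R` forwards or
backwards. -/
noncomputable def ReversibleSystem.ofCells {L K : Type u} (A : IndependenceAlphabet L)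
    (R : Set (CellRule L K)) : ReversibleSystem (A.cellRules K) where
  V := L → K
  step x d y := d.1 ∈ R ∧ (∀ g, ¬ A.indep d.1.site g → g ≠ d.1.site → x g = d.1.pre g) ∧
    x d.1.site = (if d.2 then d.1.pre d.1.site else d.1.post) ∧
      y = Function.update x d.1.site (if d.2 then d.1.post else d.1.pre d.1.site)
  step_inv {x d y} := by
    obtain ⟨t, ε⟩ := d
    dsimp only [SignedLetter.inv]
    rintro ⟨rule, others, content, rfl⟩
    refine ⟨rule, fun g hg hne => ?_, ?_, ?_⟩
    · rw [Function.update_of_ne hne, others g hg hne]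
    · cases ε <;> simp
    · rw [Function.update_idem, eq_comm, Function.update_eq_self_iff, content]
      cases ε <;> simp
  step_det h h' := h.2.2.2.trans h'.2.2.2.symm
  diamond {x d d' y y'} hI := by
    rintro ⟨rule, others, content, rfl⟩ ⟨rule', others', content', rfl⟩
    have ne : d'.1.site ≠ d.1.site := IndependenceAlphabet.ne_of_indep hI
    refine ⟨_, ⟨rule', fun g hg hne => ?_, ?_, rfl⟩, rule, fun g hg hne => ?_, ?_, ?_⟩
    · rw [Function.update_of_ne (by rintro rfl; exact hg (A.symm hI)), others' g hg hne]
    · rw [Function.update_of_ne ne, content']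
    · rw [Function.update_of_ne (by rintro rfl; exact hg hI), others g hg hne]
    · rw [Function.update_of_ne ne.symm, content]
    · exact Function.update_comm ne.symm _ _ _

namespace EventStructure

open scoped Classical
open SignedLetter IndependenceAlphabet

variable {E : Type u} [PartialOrder E] {S : EventStructure E} {c c' : Finset E} {e : E}
  {L Q : Type} {lab : E → L} {A : IndependenceAlphabet L} {q : S.Domain → Q}

variable (lab q) in
/-- The contents of the cells at a configuration: the cell `g` holds the information about the view
of `g`. -/
noncomputable def cells (c : Finset E) (g : L) : Info L (Set Q) :=
  S.info lab (stepFutures lab q) (view lab {g} c)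

variable (lab A q) in
/-- The rule by which an event changes the cells. The entries of `pre` that the rule does not read
are normalised, so that events with the same effect on the cells have the same rule. -/
noncomputable def cellRule (e : E) : CellRule L (Info L (Set Q)) where
  site := lab e
  pre g := cells lab q (if A.indep (lab e) g then ∅ else S.past e) g
  post := S.info lab (stepFutures lab q) (S.causes e)

variable (lab A q) in
/-- The system of cells with the rules of all events. -/
noncomputable def cellSystem : ReversibleSystem (A.cellRules (Info L (Set Q))) :=
  ReversibleSystem.ofCells A (Set.range (cellRule lab A q))

instance [Finite L] [Finite Q] : Finite (cellSystem lab A q).V :=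
  inferInstanceAs (Finite (L → Info L (Set Q)))

variable (lab A q) in
/-- The piling of the word of rules of a configuration. -/
noncomputable def piling (c : Finset E) : CellRule L (Info L (Set Q)) → List (Option Bool) :=
  foldEvents (fun e => (A.cellRules _).push (cellRule lab A q e, true)) c fun _ => []

theorem piling_empty : piling lab A q ∅ = fun _ => [] := foldEvents_empty _

namespace IsTraceLabeling

variable (H : S.IsTraceLabeling lab A.indep)
include H

theorem cells_eq_pre (hc : S.IsConfiguration c) (he : S.Enabled c e) {g : L}
    (hg : ¬ A.indep (lab e) g) : cells lab q c g = (cellRule lab A q e).pre g := by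
  simp only [cellRule, if_neg hg, cells, H.view_singleton_past hc he hg]

theorem step_cells (hc : S.IsConfiguration c) (he : S.Enabled c e) :
    (cellSystem lab A q).step (cells lab q c) (cellRule lab A q e, true)
      (cells lab q (insert e c)) := by
  refine ⟨⟨e, rfl⟩, fun g hg _ => H.cells_eq_pre hc he hg, H.cells_eq_pre hc he (A.irrefl _), ?_⟩
  refine (Function.update_eq_iff.2 ⟨?_, fun g hg => ?_⟩).symm
  · simp only [cells, cellRule, if_true, H.view_insert_self hc he]
  · simp only [cells, view_insert_of_ne hc hg]

theorem exists_enabled_of_step [Finite L]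
    (hq : ∀ c c', q c = q c' ↔ S.labeledFutureSetoid lab c c') (hc : S.IsConfiguration c)
    {t : CellRule L (Info L (Set Q))} {y : L → Info L (Set Q)}
    (h : (cellSystem lab A q).step (cells lab q c) (t, true) y) :
    ∃ e, S.Enabled c e ∧ cellRule lab A q e = t := by
  obtain ⟨⟨e, rfl⟩, others, content, -⟩ := h
  have read (g) (hg : ¬ A.indep (lab e) g) : cells lab q c g = cells lab q (S.past e) g := by
    have eq_pre : cells lab q c g = (cellRule lab A q e).pre g := by
      by_cases hge : g = lab e
      · exact hge ▸ content
      · exact others g hg hge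
    rw [eq_pre, H.cells_eq_pre (isConfiguration_past e) (enabled_past e) hg]
  obtain ⟨e', he', hl, post_eq⟩ := H.exists_enabled_of_info_eq hq hc read
  refine ⟨e', he', CellRule.ext hl (funext fun g => ?_) post_eq⟩
  by_cases hg : A.indep (lab e) g
  · simp only [cellRule, hl, if_pos hg]
  · rw [← H.cells_eq_pre hc he' (hl ▸ hg), read g hg,
      H.cells_eq_pre (isConfiguration_past e) (enabled_past e) hg]

theorem piling_insert (hc : S.IsConfiguration c) (he : S.Enabled c e) :
    piling lab A q (insert e c) =
      (A.cellRules _).push (cellRule lab A q e, true) (piling lab A q c) :=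
  H.foldEvents_insert (effect := fun e => (A.cellRules _).push (cellRule lab A q e, true))
    (fun hI r => push_comm hI r) (hc.insert he).1
    (fun _ hf hef => he.notMem (hc.mem_of_le hf hef)) _

theorem exists_of_isTop_piling (hc : S.IsConfiguration c)
    {d : CellRule L (Info L (Set Q)) × Bool} (h : IsTop d (piling lab A q c)) :
    ∃ c' e, S.IsConfiguration c' ∧ S.Enabled c' e ∧ c = insert e c' ∧
      d = (cellRule lab A q e, true) := by
  induction hc using IsConfiguration.induction with
  | empty => rw [piling_empty] at h; exact absurd h not_isTop_nil
  | insert c f hc hf ih =>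
    rw [H.piling_insert hc hf, isTop_push_iff] at h
    rcases h with rfl | ⟨hI, h⟩
    · exact ⟨c, f, hc, hf, rfl, rfl⟩
    · obtain ⟨c', e, hc', he, rfl, rfl⟩ := ih h
      obtain ⟨hf', he'⟩ := H.enabled_swap hc' he hf (A.symm hI)
      exact ⟨insert f c', e, hc'.insert hf', he', Finset.insert_comm _ _ _, rfl⟩

theorem not_isTop_inv_piling (hc : S.IsConfiguration c) (t : CellRule L (Info L (Set Q))) :
    ¬ IsTop (inv (t, true)) (piling lab A q c) := fun h => by
  obtain ⟨_, _, -, -, -, eq⟩ := H.exists_of_isTop_piling hc h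
  exact Bool.false_ne_true (congrArg Prod.snd eq)

theorem piling_insert_eq_act (hc : S.IsConfiguration c) (he : S.Enabled c e) :
    piling lab A q (insert e c) =
      (A.cellRules _).act (cellRule lab A q e, true) (piling lab A q c) := by
  rw [H.piling_insert hc he, act_of_not_isTop (H.not_isTop_inv_piling hc _)]

theorem isReduced_piling (hc : S.IsConfiguration c) :
    (A.cellRules _).IsReduced (piling lab A q c) := by
  induction hc using IsConfiguration.induction with
  | empty => rw [piling_empty]; exact isReduced_nil
  | insert c e hc he ih => exact H.piling_insert_eq_act hc he ▸ ih.act _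

theorem piling_injective (hc : S.IsConfiguration c) (hc' : S.IsConfiguration c')
    (h : piling lab A q c = piling lab A q c') : c = c' := by
  induction hc using IsConfiguration.induction generalizing c' with
  | empty =>
    induction hc' using IsConfiguration.induction with
    | empty => rfl
    | insert c' e hc' he _ =>
      have top := isTop_push (A := A.cellRules _) (cellRule lab A q e, true) (piling lab A q c')
      rw [← H.piling_insert hc' he, ← h, piling_empty] at top
      exact absurd top not_isTop_nil
  | insert c e hc he ih =>
    rw [H.piling_insert hc he] at h
    obtain ⟨d, f, hd, hf, rfl, rule_eq⟩ :=
      H.exists_of_isTop_piling hc' (h ▸ isTop_push (cellRule lab A q e, true) (piling lab A q c))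
    rw [H.piling_insert hd hf, ← rule_eq] at h
    have rest_eq : piling lab A q c = piling lab A q d := by
      rw [← pop_push (A := A.cellRules _) (cellRule lab A q e, true) (piling lab A q c), h,
        pop_push]
    obtain rfl := ih hd rest_eq
    rw [H.enabled_unique he hf (congrArg (fun d => d.1.site) rule_eq)]

end IsTraceLabeling

/-! ### The domain as a principal filter -/

open ReversibleSystem CubeComplex

namespace IsTraceLabeling

variable (H : S.IsTraceLabeling lab A.indep)

/-- The state of the unfolding of the cells that corresponds to a configuration. -/
noncomputable def unfold (q : S.Domain → Q) (c : S.Domain) : (cellSystem lab A q).unfolding.V :=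
  (cells lab q c.1, ⟨piling lab A q c.1, H.isReduced_piling c.2⟩)

theorem unfold_empty :
    H.unfold q ⟨∅, isConfiguration_empty⟩ = (cellSystem lab A q).root (cells lab q ∅) :=
  Prod.ext rfl (Subtype.ext piling_empty)

theorem unfold_injective : Function.Injective (H.unfold q) := fun c d h =>
  Subtype.ext (H.piling_injective c.2 d.2 (congrArg (fun v => v.2.1) h))

theorem step_unfold (c : S.Domain) (he : S.Enabled c.1 e) :
    (cellSystem lab A q).unfolding.step (H.unfold q c) (cellRule lab A q e, true)
      (H.unfold q (c.add he)) :=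
  ⟨H.step_cells c.2 he, H.piling_insert_eq_act c.2 he⟩

theorem posReach_unfold_of_le {c d : S.Domain} (h : c ≤ d) :
    (cellSystem lab A q).unfolding.PosReach (H.unfold q c) (H.unfold q d) :=
  c.2.induction_of_subset
    (P := fun d hd => (cellSystem lab A q).unfolding.PosReach (H.unfold q c) (H.unfold q ⟨d, hd⟩))
    .refl (fun d _ hd he _ ih => ih.tail ⟨_, H.step_unfold ⟨d, hd⟩ he⟩) d.2 h

theorem exists_of_posReach [Finite L]
    (hq : ∀ c c', q c = q c' ↔ S.labeledFutureSetoid lab c c') {c : S.Domain}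
    {v : (cellSystem lab A q).unfolding.V}
    (h : (cellSystem lab A q).unfolding.PosReach (H.unfold q c) v) :
    ∃ d, c ≤ d ∧ H.unfold q d = v := by
  induction h with
  | refl => exact ⟨c, le_rfl, rfl⟩
  | tail _ h ih =>
    obtain ⟨d, hd, rfl⟩ := ih
    obtain ⟨t, h⟩ := h
    obtain ⟨e, he, rfl⟩ := H.exists_enabled_of_step hq d.2 h.1
    exact ⟨d.add he, hd.trans (Finset.subset_insert _ _),
      (cellSystem lab A q).unfolding.step_det (H.step_unfold d he) h⟩

theorem posReach_unfold_iff [Finite L]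
    (hq : ∀ c c', q c = q c' ↔ S.labeledFutureSetoid lab c c') {c d : S.Domain} :
    (cellSystem lab A q).unfolding.PosReach (H.unfold q c) (H.unfold q d) ↔ c ≤ d := by
  refine ⟨fun h => ?_, H.posReach_unfold_of_le⟩
  obtain ⟨d', hd', eq⟩ := H.exists_of_posReach hq h
  rwa [← H.unfold_injective eq]

theorem posReach_root_iff [Finite L]
    (hq : ∀ c c', q c = q c' ↔ S.labeledFutureSetoid lab c c')
    {v : (cellSystem lab A q).unfolding.V} :
    (cellSystem lab A q).unfolding.PosReach ((cellSystem lab A q).root (cells lab q ∅)) v ↔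
      v ∈ Set.range (H.unfold q) := by
  rw [← H.unfold_empty]
  constructor
  · intro h
    obtain ⟨c, -, hc⟩ := H.exists_of_posReach hq h
    exact ⟨c, hc⟩
  · rintro ⟨c, rfl⟩
    exact H.posReach_unfold_of_le (Finset.empty_subset c.1)

end IsTraceLabeling

theorem isVirtuallySpecial_cellSystem [Finite L] [Finite Q] :
    ((cellSystem lab A q).component (cells lab q ∅)).complex.IsVirtuallySpecial :=
  have : Finite ((cellSystem lab A q).component (cells lab q ∅)).V := Subtype.finite
  isVirtuallySpecial_complex

end EventStructure

theorem mainTheorem6 {E : Type u} [PartialOrder E] (S : EventStructure E)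
    (hS : S.IsTraceRegular) : S.IsCoverSpecial ∧ S.IsStronglyRegular := by
  obtain ⟨L, _, _, I, lab, hirr, hsymm, H, hfin⟩ := hS
  let A : IndependenceAlphabet L := ⟨I, hirr, hsymm _ _⟩
  have : Finite (Quotient (S.labeledFutureSetoid lab)) := hfin
  obtain ⟨n, ⟨φ⟩⟩ := Finite.exists_equiv_fin (Quotient (S.labeledFutureSetoid lab))
  let q (c : S.Domain) : Fin n := φ (Quotient.mk _ c)
  have hq (c c') : q c = q c' ↔ S.labeledFutureSetoid lab c c' :=
    φ.apply_eq_iff_eq.trans Quotient.eq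
  have filter := ReversibleSystem.domainIsFilterOfUniversalCover
    (EventStructure.IsTraceLabeling.posReach_unfold_iff (A := A) H hq)
    (EventStructure.IsTraceLabeling.posReach_root_iff H hq)
  have special := EventStructure.isVirtuallySpecial_cellSystem (lab := lab) (A := A) (q := q)
  have regular : S.IsStronglyRegular := ⟨_, special.1, special.2.1, filter⟩
  exact ⟨⟨regular, _, special, filter⟩, regular⟩
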